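/- Let $K$ be an infinite field, let $n, r, d \ge 0$ be integers, and let $\Gamma \subset \mathbb{P}^n$ be a finite set of ($K$-rational) points satisfying the Cayley--Bacharach condition $\mathrm{CB}(r)$: whenever a homogeneous polynomial of degree $r$ (the zero polynomial allowed) vanishes at all points of $\Gamma$ but one, it vanishes at the last point too. A plane configuration in $\mathbb{P}^n$ is a finite (possibly empty) collection $\mathcal{P} = \{P_1, \dots, P_k\}$ of distinct positive-dimensional linear subspaces of $\mathbb{P}^n$; its dimension is $\dim \mathcal{P} = \sum_i \dim P_i$, its length is $\ell(\mathcal{P}) = k$, and $\Gamma$ lies on $\mathcal{P}$ if $\Gamma \subset P_1 \cup \dots \cup P_k$. Suppose that $|\Gamma| \le (d+1)r + 1$. Then in each of the following cases $\Gamma$ lies on a plane configuration $\mathcal{P}$ of dimension $\min(d,n)$ (that is, of dimension $d$ whenever $d \le n$), with the stated bound on its length. (i) $r \le 2$ and $d$ is arbitrary; moreover, if $d \ge 1$ and $n \ge 1$, one may take $\ell(\mathcal{P}) = 1$, i.e. $\Gamma$ lies on a single linear space of dimension $\min(d,n)$. (ii) $d \le 3$ and $r$ is arbitrary; moreover, if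 $r \le 4$, one may take $\ell(\mathcal{P}) \le 2$. (iii) $d = 4$ and $r = 3$; moreover, one may take $\ell(\mathcal{P}) \le 2$. -/

import Mathlib

open scoped LinearAlgebra.Projectivization

/-- Projective `n`-space over the field `K`. -/
abbrev ProjSpace (K : Type*) [Field K] (n : ℕ) : Type _ := ℙ K (Fin (n + 1) → K)

/-- A polynomial `F` in `n + 1` variables vanishes at the point `p` of projective `n`-space.
For homogeneous `F` this does not depend on the chosen representative of `p`, see
`vanishesAt_mk_iff`. -/
def VanishesAt {K : Type*} [Field K] {n : ℕ} (F : MvPolynomial (Fin (n + 1)) K)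
    (p : ProjSpace K n) : Prop :=
  MvPolynomial.eval p.rep F = 0

theorem vanishesAt_mk_iff {K : Type*} [Field K] {n r : ℕ} {F : MvPolynomial (Fin (n + 1)) K}
    (hF : F.IsHomogeneous r) (v : Fin (n + 1) → K) (hv : v ≠ 0) :
    VanishesAt F (Projectivization.mk K v hv) ↔ MvPolynomial.eval v F = 0 := by
  obtain ⟨a, ha⟩ := Projectivization.exists_smul_eq_mk_rep K v hv
  have h : MvPolynomial.eval ((a : K) • v) F = (a : K) ^ r * MvPolynomial.eval v F := by
    rw [MvPolynomial.eval_eq, MvPolynomial.eval_eq, Finset.mul_sum]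
    refine Finset.sum_congr rfl fun m hm => ?_
    have hd : ∑ i ∈ m.support, m i = r := by
      have h2 := hF (MvPolynomial.mem_support_iff.1 hm)
      simpa [Finsupp.weight_apply, Finsupp.sum] using h2
    simp only [Pi.smul_apply, smul_eq_mul, mul_pow, Finset.prod_mul_distrib]
    rw [Finset.prod_pow_eq_pow_sum, hd]
    ring
  unfold VanishesAt
  rw [← ha, Units.smul_def, h]
  simp

/-- The Cayley--Bacharach condition `CB(r)`: every homogeneous polynomial of degree `r` that
vanishes at all points of `Γ` but one vanishes at that last point too. -/
def CayleyBacharach {K : Type*} [Field K] {n : ℕ} (r : ℕ) (Γ : Set (ProjSpace K n)) : Prop :=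
  ∀ F : MvPolynomial (Fin (n + 1)) K, F.IsHomogeneous r →
    ∀ x ∈ Γ, (∀ y ∈ Γ, y ≠ x → VanishesAt F y) → VanishesAt F x

/-- The dimension of a linear subspace of projective space. The subtraction is truncated, so the
empty subspace (of dimension `-1` in the usual convention) gets the value `0`. -/
noncomputable def projDim {K : Type*} [Field K] {n : ℕ}
    (P : Projectivization.Subspace K (Fin (n + 1) → K)) : ℕ :=
  Module.finrank K P.submodule - 1

/-- A plane configuration in projective `n`-space: finitely many distinct linear subspaces, each
of positive dimension. The empty configuration is allowed. -/
structure PlaneConfiguration (K : Type*) [Field K] (n : ℕ) where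
  planes : Finset (Projectivization.Subspace K (Fin (n + 1) → K))
  projDim_pos : ∀ P ∈ planes, 0 < projDim P

namespace PlaneConfiguration

variable {K : Type*} [Field K] {n : ℕ}

/-- The underlying set of points: the union of the members. -/
def carrier (C : PlaneConfiguration K n) : Set (ProjSpace K n) :=
  {x | ∃ P ∈ C.planes, x ∈ P}

/-- The dimension of a plane configuration is the sum of the dimensions of its members. -/
noncomputable def dim (C : PlaneConfiguration K n) : ℕ := ∑ P ∈ C.planes, projDim P

/-- The length of a plane configuration is the number of its members. -/
def length (C : PlaneConfiguration K n) : ℕ := C.planes.card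

end PlaneConfiguration

/-! ### Homogeneous forms as functions -/

section Forms

variable {K : Type*} [Field K] {n : ℕ}

/-! Two operations carry the Cayley–Bacharach condition to smaller sets. Discarding the points on a
linear space lowers the degree by one (`CayleyBacharach.remove`): multiply a form by a linear form
vanishing on the space. If `Γ` lies on two linear spaces meeting in at most a point, discarding one
of them keeps the degree, at the price of possibly adding the meeting point
(`CayleyBacharach.residual`): pull forms back along a linear retraction onto the other space.

The basic lower bounds on cardinality are `r + 2` for a nonempty set
(`CayleyBacharach.add_two_le_card`) and, in degree 2, twice the rank
(`CayleyBacharach.two_mul_prank_le_card`). The latter settles the essential case of `r ≤ 2`.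

For `d ≤ 3`, induct on `r`. Choose a space `W` of projective dimension `d` containing as many points
as possible (`exists_maximal_onPart`). It catches at least `d + 1` points, so the rest satisfies the
induction hypothesis in degree `r - 1`. If the rest lies on a line, the second operation keeps
degree `r` and reduces `d` by one. Otherwise the rest has many points in some small space;
maximality then puts at least as many on `W`, and the total is too large. Sets on skew spaces split
into parts each satisfying the condition, which supplies the counts.

For `d = 4`, `r = 3` the same scheme leaves one extremal pattern: 16 points with six on each of two
planes and four elsewhere. Removing suitable pairs of spaces forces the four points into a
three-space with one of the planes, contradicting maximality. -/

/-- A function on `K ^ (n + 1)` given by a homogeneous polynomial of degree `r`. -/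
def IsForm (r : ℕ) (f : (Fin (n + 1) → K) → K) : Prop :=
  ∃ F : MvPolynomial (Fin (n + 1)) K, F.IsHomogeneous r ∧ ∀ v, MvPolynomial.eval v F = f v

theorem isForm_const (c : K) : IsForm 0 (fun _ : Fin (n + 1) → K => c) :=
  ⟨MvPolynomial.C c, MvPolynomial.isHomogeneous_C _ c, fun _ => MvPolynomial.eval_C c⟩

theorem isForm_linear (l : Module.Dual K (Fin (n + 1) → K)) : IsForm 1 (fun v => l v) := by
  refine ⟨∑ i, MvPolynomial.C (l (Pi.single i 1)) * MvPolynomial.X i,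
    MvPolynomial.IsHomogeneous.sum _ _ _ fun i _ =>
      MvPolynomial.isHomogeneous_C_mul_X _ i, fun v => ?_⟩
  beta_reduce
  rw [LinearMap.pi_apply_eq_sum_univ l v]
  simp only [map_sum, map_mul, MvPolynomial.eval_C, MvPolynomial.eval_X, smul_eq_mul]
  refine Finset.sum_congr rfl fun i _ => ?_
  rw [mul_comm]
  congr 2
  ext j
  simp [Pi.single_apply, eq_comm]

theorem IsForm.mul {r s : ℕ} {f g : (Fin (n + 1) → K) → K} (hf : IsForm r f) (hg : IsForm s g) :
    IsForm (r + s) (fun v => f v * g v) := by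
  obtain ⟨F, hF, hF'⟩ := hf
  obtain ⟨G, hG, hG'⟩ := hg
  exact ⟨F * G, hF.mul hG, fun v => by rw [map_mul, hF', hG']⟩

theorem IsForm.sub {r : ℕ} {f g : (Fin (n + 1) → K) → K} (hf : IsForm r f) (hg : IsForm r g) :
    IsForm r (fun v => f v - g v) := by
  obtain ⟨F, hF, hF'⟩ := hf
  obtain ⟨G, hG, hG'⟩ := hg
  exact ⟨F - G, hF.sub hG, fun v => by rw [map_sub, hF', hG']⟩

theorem IsForm.const_mul {r : ℕ} {f : (Fin (n + 1) → K) → K} (c : K) (hf : IsForm r f) :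
    IsForm r (fun v => c * f v) := by
  simpa using (isForm_const c).mul hf

theorem IsForm.comp_linearMap {r : ℕ} {f : (Fin (n + 1) → K) → K} (hf : IsForm r f)
    (φ : (Fin (n + 1) → K) →ₗ[K] (Fin (n + 1) → K)) : IsForm r (fun v => f (φ v)) := by
  obtain ⟨F, hF, hF'⟩ := hf
  choose L hL hL' using fun i => isForm_linear ((LinearMap.proj i).comp φ)
  refine ⟨MvPolynomial.aeval L F, ?_, fun v => ?_⟩
  · simpa using hF.aeval L hL
  · beta_reduce
    rw [← hF', ← MvPolynomial.coe_aeval_eq_eval, ← MvPolynomial.coe_aeval_eq_eval]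
    simp only [RingHom.coe_coe]
    rw [← AlgHom.comp_apply, MvPolynomial.comp_aeval]
    congr 2
    funext i
    simpa using hL' i v

theorem IsForm.map_smul {r : ℕ} {f : (Fin (n + 1) → K) → K} (hf : IsForm r f) (c : K)
    (v : Fin (n + 1) → K) : f (c • v) = c ^ r * f v := by
  obtain ⟨F, hF, hF'⟩ := hf
  rw [← hF', ← hF', MvPolynomial.eval_eq, MvPolynomial.eval_eq, Finset.mul_sum]
  refine Finset.sum_congr rfl fun m hm => ?_
  have hd : ∑ i ∈ m.support, m i = r := by
    have h2 := hF (MvPolynomial.mem_support_iff.1 hm)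
    simpa [Finsupp.weight_apply, Finsupp.sum] using h2
  simp only [Pi.smul_apply, smul_eq_mul, mul_pow, Finset.prod_mul_distrib]
  rw [Finset.prod_pow_eq_pow_sum, hd]
  ring

theorem IsForm.map_zero {r : ℕ} {f : (Fin (n + 1) → K) → K} (hf : IsForm r f) (hr : 1 ≤ r) :
    f 0 = 0 := by
  have h := hf.map_smul 0 0
  rwa [zero_smul, zero_pow (by omega), zero_mul] at h

theorem CayleyBacharach.form_eq_zero {r : ℕ} {Γ : Set (ProjSpace K n)} (h : CayleyBacharach r Γ)
    {f : (Fin (n + 1) → K) → K} (hf : IsForm r f) {x : ProjSpace K n} (hx : x ∈ Γ)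
    (h0 : ∀ y ∈ Γ, y ≠ x → f y.rep = 0) : f x.rep = 0 := by
  obtain ⟨F, hF, hF'⟩ := hf
  rw [← hF']
  exact h F hF x hx fun y hy hyx => (hF' _).trans (h0 y hy hyx)

theorem cayleyBacharach_of_forms {r : ℕ} {Γ : Set (ProjSpace K n)}
    (h : ∀ f : (Fin (n + 1) → K) → K, IsForm r f → ∀ x ∈ Γ,
      (∀ y ∈ Γ, y ≠ x → f y.rep = 0) → f x.rep = 0) : CayleyBacharach r Γ :=
  fun F hF x hx h0 => h (fun v => MvPolynomial.eval v F) ⟨F, hF, fun _ => rfl⟩ x hx h0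

end Forms

/-! ### Removing the points on a linear space -/

section Parts

variable {K : Type*} [Field K] {n : ℕ}

open Classical in
/-- The points of `Γ` on the linear subspace `U`. -/
noncomputable def onPart (Γ : Finset (ProjSpace K n)) (U : Submodule K (Fin (n + 1) → K)) :
    Finset (ProjSpace K n) :=
  Γ.filter fun x => x.rep ∈ U

open Classical in
/-- The points of `Γ` off the linear subspace `U`. -/
noncomputable def offPart (Γ : Finset (ProjSpace K n)) (U : Submodule K (Fin (n + 1) → K)) :
    Finset (ProjSpace K n) :=
  Γ.filter fun x => x.rep ∉ U

variable {Γ : Finset (ProjSpace K n)} {U W : Submodule K (Fin (n + 1) → K)} {x : ProjSpace K n}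

@[simp]
theorem mem_onPart : x ∈ onPart Γ U ↔ x ∈ Γ ∧ x.rep ∈ U := by simp [onPart]

@[simp]
theorem mem_offPart : x ∈ offPart Γ U ↔ x ∈ Γ ∧ x.rep ∉ U := by simp [offPart]

theorem card_onPart_add_card_offPart (Γ : Finset (ProjSpace K n))
    (U : Submodule K (Fin (n + 1) → K)) : (onPart Γ U).card + (offPart Γ U).card = Γ.card := by
  classical
  exact Finset.card_filter_add_card_filter_not _

theorem onPart_subset_onPart (h : U ≤ W) : onPart Γ U ⊆ onPart Γ W := fun x hx => by
  rw [mem_onPart] at *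
  exact ⟨hx.1, h hx.2⟩

/-- Multiply the form by a linear form that vanishes on `U` but not at `x`; the product is a test
form for `Γ`, and the linear factor can be cancelled at `x`. -/
theorem CayleyBacharach.remove {r : ℕ} (h : CayleyBacharach (r + 1) (Γ : Set (ProjSpace K n)))
    (U : Submodule K (Fin (n + 1) → K)) :
    CayleyBacharach r (offPart Γ U : Set (ProjSpace K n)) := by
  refine cayleyBacharach_of_forms fun f hf x hx h0 => ?_
  simp only [Finset.mem_coe, mem_offPart] at hx h0
  obtain ⟨l, hl, hU⟩ := Submodule.exists_le_ker_of_notMem hx.2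
  have := h.form_eq_zero (hf.mul (isForm_linear l)) hx.1 fun y hy hyx => by
    by_cases hyU : y.rep ∈ U
    · rw [show l y.rep = 0 from hU hyU, mul_zero]
    · rw [h0 y ⟨hy, hyU⟩ hyx, zero_mul]
  exact (mul_eq_zero.1 this).resolve_right hl

theorem CayleyBacharach.of_succ {r : ℕ} (h : CayleyBacharach (r + 1) (Γ : Set (ProjSpace K n))) :
    CayleyBacharach r (Γ : Set (ProjSpace K n)) := by
  have h1 := h.remove ⊥
  have h2 : offPart Γ ⊥ = Γ := by
    ext x
    simp [x.rep_nonzero]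
  rwa [h2] at h1

theorem CayleyBacharach.two_le_card {r : ℕ} (h : CayleyBacharach r (Γ : Set (ProjSpace K n)))
    (hΓ : Γ.Nonempty) : 2 ≤ Γ.card := by
  induction r with
  | zero =>
    obtain ⟨x, hx⟩ := hΓ
    by_contra! hc
    have h1 := h.form_eq_zero (isForm_const 1) hx fun y hy hyx =>
      absurd (Finset.card_le_one.1 (by omega) y hy x hx) hyx
    exact one_ne_zero h1
  | succ r ih => exact ih h.of_succ

theorem rep_mem_span_rep_iff {y : ProjSpace K n} :
    y.rep ∈ Submodule.span K {x.rep} ↔ y = x := by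
  refine ⟨fun h => ?_, fun h => h ▸ Submodule.mem_span_singleton_self _⟩
  obtain ⟨a, ha⟩ := Submodule.mem_span_singleton.1 h
  rw [← x.mk_rep, ← y.mk_rep, Projectivization.mk_eq_mk_iff']
  exact ⟨a, ha⟩

/-- A nonempty set with `CB(r)` has at least `r + 2` points. -/
theorem CayleyBacharach.add_two_le_card {r : ℕ}
    (h : CayleyBacharach r (Γ : Set (ProjSpace K n))) (hΓ : Γ.Nonempty) : r + 2 ≤ Γ.card := by
  induction r generalizing Γ with
  | zero => exact h.two_le_card hΓ
  | succ r ih =>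
    -- Removing the single point `x` costs one degree, and `y` keeps the residual set nonempty.
    obtain ⟨x, hx, y, hy, hxy⟩ := Finset.one_lt_card.1 (h.two_le_card hΓ)
    have h1 := ih (h.remove (Submodule.span K {x.rep}))
      ⟨y, mem_offPart.2 ⟨hy, fun h => hxy (rep_mem_span_rep_iff.1 h).symm⟩⟩
    have h2 := card_onPart_add_card_offPart Γ (Submodule.span K {x.rep})
    have h3 : 0 < (onPart Γ (Submodule.span K {x.rep})).card :=
      Finset.card_pos.2 ⟨x, mem_onPart.2 ⟨hx, Submodule.mem_span_singleton_self _⟩⟩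
    omega

end Parts

/-! ### Ranks, maximal subspaces, and bounds in degrees one and two -/

section Rank

variable {K : Type*} [Field K] {n : ℕ}

/-- The linear span of the cone over `Γ`. -/
def pspan (Γ : Finset (ProjSpace K n)) : Submodule K (Fin (n + 1) → K) :=
  Submodule.span K (Projectivization.rep '' (Γ : Set (ProjSpace K n)))

/-- The dimension of the linear span of the cone over `Γ`. -/
noncomputable def prank (Γ : Finset (ProjSpace K n)) : ℕ := Module.finrank K (pspan Γ)

variable {Γ Δ : Finset (ProjSpace K n)} {U W : Submodule K (Fin (n + 1) → K)} {x : ProjSpace K n}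

theorem rep_mem_pspan (hx : x ∈ Γ) : x.rep ∈ pspan Γ :=
  Submodule.subset_span ⟨x, hx, rfl⟩

theorem pspan_le : pspan Γ ≤ U ↔ ∀ x ∈ Γ, x.rep ∈ U := by
  simp [pspan, Submodule.span_le, Set.subset_def]

theorem prank_le_finrank (h : ∀ x ∈ Γ, x.rep ∈ U) : prank Γ ≤ Module.finrank K U :=
  Submodule.finrank_mono (pspan_le.2 h)

theorem prank_mono (h : Γ ⊆ Δ) : prank Γ ≤ prank Δ :=
  prank_le_finrank fun _ hx => rep_mem_pspan (h hx)

theorem exists_rep_notMem (h : Module.finrank K U < prank Γ) : ∃ x ∈ Γ, x.rep ∉ U := by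
  by_contra! h1
  exact absurd (prank_le_finrank h1) (by omega)

theorem prank_le_card (Γ : Finset (ProjSpace K n)) : prank Γ ≤ Γ.card := by
  classical
  have h := finrank_span_finset_le_card (R := K) (Γ.image Projectivization.rep)
  rw [Set.finrank, Finset.coe_image] at h
  exact h.trans Finset.card_image_le

theorem finrank_sup_le (U W : Submodule K (Fin (n + 1) → K)) :
    Module.finrank K ↥(U ⊔ W) ≤ Module.finrank K U + Module.finrank K W :=
  Submodule.finrank_add_le_finrank_add_finrank U W

theorem finrank_span_rep (x : ProjSpace K n) :
    Module.finrank K (Submodule.span K {x.rep}) = 1 :=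
  finrank_span_singleton x.rep_nonzero

theorem finrank_sup_span_rep (h : x.rep ∉ U) :
    Module.finrank K ↥(U ⊔ Submodule.span K {x.rep}) = Module.finrank K U + 1 := by
  have h1 := finrank_sup_le U (Submodule.span K {x.rep})
  rw [finrank_span_rep] at h1
  have h2 : U < U ⊔ Submodule.span K {x.rep} := by
    refine lt_of_le_of_ne le_sup_left fun he => h ?_
    rw [he]
    exact Submodule.mem_sup_right (Submodule.mem_span_singleton_self _)
  have h3 := Submodule.finrank_lt_finrank_of_lt h2
  omega

theorem finrank_pos_of_rep_mem (h : x.rep ∈ U) : 1 ≤ Module.finrank K U := by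
  have h1 : Submodule.span K {x.rep} ≤ U := by simpa using h
  have h2 := Submodule.finrank_mono h1
  rwa [finrank_span_rep] at h2

theorem finrank_sup_lt_of_rep_mem (hU : x.rep ∈ U) (hW : x.rep ∈ W) :
    Module.finrank K ↥(U ⊔ W) + 1 ≤ Module.finrank K U + Module.finrank K W := by
  have h1 := Submodule.finrank_sup_add_finrank_inf_eq U W
  have h2 : 1 ≤ Module.finrank K ↥(U ⊓ W) := finrank_pos_of_rep_mem ⟨hU, hW⟩
  omega

theorem inf_eq_bot_of_finrank
    (h : Module.finrank K U + Module.finrank K W ≤ Module.finrank K ↥(U ⊔ W)) : U ⊓ W = ⊥ := by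
  have h1 := Submodule.finrank_sup_add_finrank_inf_eq U W
  exact Submodule.finrank_eq_zero.1 (by omega)

theorem card_le_one_of_finrank_le_one (hU : Module.finrank K U ≤ 1) (h : ∀ x ∈ Γ, x.rep ∈ U) :
    Γ.card ≤ 1 := by
  refine Finset.card_le_one.2 fun x hx y hy => ?_
  by_contra hxy
  have h1 : Submodule.span K {y.rep} ⊔ Submodule.span K {x.rep} ≤ U := by
    simp [h x hx, h y hy]
  have h2 := Submodule.finrank_mono h1
  rw [finrank_sup_span_rep fun h => hxy (rep_mem_span_rep_iff.1 h), finrank_span_rep] at h2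
  omega

theorem card_onPart_sup_span_rep (hx : x ∈ Γ) (hxU : x.rep ∉ U) :
    (onPart Γ U).card + 1 ≤ (onPart Γ (U ⊔ Submodule.span K {x.rep})).card := by
  refine Finset.card_lt_card ⟨onPart_subset_onPart le_sup_left, fun h => hxU ?_⟩
  have h1 : x ∈ onPart Γ (U ⊔ Submodule.span K {x.rep}) := mem_onPart.2
    ⟨hx, Submodule.mem_sup_right (Submodule.mem_span_singleton_self _)⟩
  exact (mem_onPart.1 (h h1)).2

/-- A subspace can be enlarged to any dimension up to the rank of `Γ`, each step catching at
least one more point of `Γ`. -/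
theorem exists_extension {j : ℕ} (U : Submodule K (Fin (n + 1) → K))
    (hU : Module.finrank K U ≤ j) (hj : j ≤ prank Γ) :
    ∃ W, U ≤ W ∧ Module.finrank K W = j ∧
      (onPart Γ U).card + j ≤ (onPart Γ W).card + Module.finrank K U := by
  induction hk : j - Module.finrank K U generalizing U with
  | zero => exact ⟨U, le_rfl, by omega, by omega⟩
  | succ k ih =>
    obtain ⟨x, hx, hxU⟩ := exists_rep_notMem (Γ := Γ) (U := U) (by omega)
    have h1 := finrank_sup_span_rep hxU
    have h2 := card_onPart_sup_span_rep hx hxU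
    obtain ⟨W, hW, hW', hW''⟩ := ih (U ⊔ Submodule.span K {x.rep}) (by omega) (by omega)
    exact ⟨W, le_sup_left.trans hW, hW', by omega⟩

/-- A subspace of given dimension with the largest possible number of points of `Γ`. -/
theorem exists_maximal_onPart {j : ℕ} (hj : j ≤ prank Γ) :
    ∃ W : Submodule K (Fin (n + 1) → K), Module.finrank K W = j ∧ j ≤ (onPart Γ W).card ∧
      ∀ U : Submodule K (Fin (n + 1) → K), Module.finrank K U ≤ j →
        (onPart Γ U).card + j ≤ (onPart Γ W).card + Module.finrank K U := by
  classical
  let P : ℕ → Prop := fun m => ∃ W : Submodule K (Fin (n + 1) → K),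
    Module.finrank K W = j ∧ (onPart Γ W).card = m
  have hb : ∀ m, P m → m ≤ Γ.card := by
    rintro m ⟨W, -, rfl⟩
    have := card_onPart_add_card_offPart Γ W
    omega
  obtain ⟨W₀, -, hW₀, -⟩ := exists_extension (Γ := Γ) (j := j) ⊥ (by simp) hj
  have hP := Nat.findGreatest_spec (P := P) (hb _ ⟨W₀, hW₀, rfl⟩) ⟨W₀, hW₀, rfl⟩
  obtain ⟨W, hW, hc⟩ := hP
  have hmax : ∀ U : Submodule K (Fin (n + 1) → K), Module.finrank K U ≤ j →
      (onPart Γ U).card + j ≤ (onPart Γ W).card + Module.finrank K U := by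
    intro U hU
    obtain ⟨W₁, -, h1, h2⟩ := exists_extension (Γ := Γ) U hU hj
    have h3 := Nat.le_findGreatest (P := P) (hb _ ⟨W₁, h1, rfl⟩) ⟨W₁, h1, rfl⟩
    omega
  refine ⟨W, hW, ?_, hmax⟩
  have := hmax ⊥ (by simp)
  rw [finrank_bot] at this
  omega

theorem card_le_card_onPart (hs : Δ ⊆ Γ) (h : ∀ x ∈ Δ, x.rep ∈ U) :
    Δ.card ≤ (onPart Γ U).card :=
  Finset.card_le_card fun x hx => mem_onPart.2 ⟨hs hx, h x hx⟩

theorem offPart_subset : offPart Γ U ⊆ Γ := fun _ hx => (mem_offPart.1 hx).1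

theorem onPart_subset : onPart Γ U ⊆ Γ := fun _ hx => (mem_onPart.1 hx).1

/-- If the points were independent, removing the span of all but one would leave a single point,
which cannot satisfy `CB(0)`. -/
theorem CayleyBacharach.prank_lt_card (h : CayleyBacharach 1 (Γ : Set (ProjSpace K n)))
    (hΓ : Γ.Nonempty) : prank Γ + 1 ≤ Γ.card := by
  classical
  by_contra! hlt
  obtain ⟨x, hx⟩ := hΓ
  have h1 : (offPart Γ (pspan (Γ.erase x))).Nonempty := by
    obtain ⟨y, hy, hyn⟩ := exists_rep_notMem (Γ := Γ) (U := pspan (Γ.erase x)) (by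
      have := prank_le_card (Γ.erase x)
      have h2 := Finset.card_erase_lt_of_mem hx
      simp only [prank] at *
      omega)
    exact ⟨y, mem_offPart.2 ⟨hy, hyn⟩⟩
  have h2 := (h.remove (pspan (Γ.erase x))).two_le_card h1
  have h3 : offPart Γ (pspan (Γ.erase x)) ⊆ {x} := fun y hy => by
    rw [mem_offPart] at hy
    by_contra hyx
    exact hy.2 (rep_mem_pspan (Finset.mem_erase.2 ⟨by simpa using hyx, hy.1⟩))
  have h4 := Finset.card_le_card h3
  simp at h4
  omega

theorem exists_basis_subset (Γ : Finset (ProjSpace K n)) :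
    ∃ B ⊆ Γ, B.card = prank Γ ∧ pspan B = pspan Γ := by
  induction hk : Γ.card - prank Γ generalizing Γ with
  | zero => exact ⟨Γ, subset_rfl, by have := prank_le_card Γ; omega, rfl⟩
  | succ k ih =>
    classical
    have h1 : ∃ x ∈ Γ, x.rep ∈ pspan (Γ.erase x) := by
      by_contra! hne
      suffices h : LinearIndependent K (fun x : Γ => x.1.rep) by
        have h2 := linearIndependent_iff_card_eq_finrank_span.1 h
        have h3 : Set.range (fun x : Γ => x.1.rep) =
            Projectivization.rep '' (Γ : Set (ProjSpace K n)) := by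
          ext v
          simp
        rw [h3, Fintype.card_coe] at h2
        have h4 : Γ.card = prank Γ := h2
        omega
      rw [linearIndependent_iff_notMem_span]
      intro x hx
      refine hne x x.2 (Submodule.span_mono ?_ hx)
      rintro _ ⟨y, hy, rfl⟩
      exact ⟨y, Finset.mem_coe.2 (Finset.mem_erase.2 ⟨fun h => hy.2 (Subtype.ext h), y.2⟩), rfl⟩
    obtain ⟨x, hx, hxs⟩ := h1
    have h2 : pspan (Γ.erase x) = pspan Γ := by
      refine le_antisymm (pspan_le.2 fun y hy => rep_mem_pspan (Finset.mem_of_mem_erase hy))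
        (pspan_le.2 fun y hy => ?_)
      by_cases hyx : y = x
      · rwa [hyx]
      · exact rep_mem_pspan (Finset.mem_erase.2 ⟨hyx, hy⟩)
    have h3 := Finset.card_erase_of_mem hx
    have h4 : prank (Γ.erase x) = prank Γ := by rw [prank, h2, prank]
    obtain ⟨B, hB, hc, hs⟩ := ih (Γ.erase x) (by omega)
    exact ⟨B, hB.trans (Finset.erase_subset _ _), hc.trans h4, hs.trans h2⟩

/-- Take a basis `B` inside `Γ`. If the other points are too few to span, the points off their span
form a nonempty subset of `B` with `CB(1)`. Such a set is dependent, whereas subsets of `B` are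
independent. -/
theorem CayleyBacharach.two_mul_prank_le_card (h : CayleyBacharach 2 (Γ : Set (ProjSpace K n))) :
    2 * prank Γ ≤ Γ.card := by
  classical
  by_contra! hlt
  obtain ⟨B, hB, hc, hs⟩ := exists_basis_subset Γ
  have h1 := prank_le_card (Γ \ B)
  have h2 := Finset.card_sdiff_add_card_eq_card hB
  obtain ⟨x, hx, hxn⟩ := exists_rep_notMem (Γ := Γ) (U := pspan (Γ \ B))
    (by simp only [prank] at *; omega)
  have h3 := (h.remove (pspan (Γ \ B))).prank_lt_card ⟨x, mem_offPart.2 ⟨hx, hxn⟩⟩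
  set D := offPart Γ (pspan (Γ \ B)) with hD
  have hDB : D ⊆ B := fun y hy => by
    rw [hD, mem_offPart] at hy
    by_contra hyB
    exact hy.2 (rep_mem_pspan (Finset.mem_sdiff.2 ⟨hy.1, hyB⟩))
  have h4 : pspan B ≤ pspan D ⊔ pspan (B \ D) := pspan_le.2 fun y hy => by
    by_cases hyD : y ∈ D
    · exact Submodule.mem_sup_left (rep_mem_pspan hyD)
    · exact Submodule.mem_sup_right (rep_mem_pspan (Finset.mem_sdiff.2 ⟨hy, hyD⟩))
  have h5 := (Submodule.finrank_mono h4).trans (finrank_sup_le _ _)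
  have h6 := prank_le_card (B \ D)
  have h7 := Finset.card_sdiff_add_card_eq_card hDB
  rw [hs] at h5
  simp only [prank] at *
  omega

end Rank

/-! ### Residual sets that keep the degree -/

section Residual

variable {K : Type*} [Field K] {n : ℕ}
variable {Γ : Finset (ProjSpace K n)} {U W : Submodule K (Fin (n + 1) → K)}

/-- A form vanishing on `U ⊓ W`, composed with `φ`, is unchanged on `U` and vanishes on all of `W`.
This removes `W` without spending a degree. -/
theorem exists_retraction (U W : Submodule K (Fin (n + 1) → K)) :
    ∃ φ : (Fin (n + 1) → K) →ₗ[K] (Fin (n + 1) → K),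
      (∀ v ∈ U, φ v = v) ∧ ∀ v ∈ W, φ v ∈ U ⊓ W := by
  obtain ⟨T, hT⟩ := exists_isCompl (U ⊓ W)
  have h1 : Disjoint (W ⊓ T) U := by
    rw [disjoint_iff_inf_le]
    calc W ⊓ T ⊓ U ≤ (U ⊓ W) ⊓ T := le_of_eq (by ac_rfl)
      _ ≤ ⊥ := hT.disjoint.le_bot
  -- `W` is the sum of `U ⊓ W` and `W ⊓ T`. Projecting to `U` along a complement containing the
  -- second summand kills it and fixes the first.
  obtain ⟨C, hC, hCU⟩ := h1.exists_isCompl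
  refine ⟨U.projection C hCU.symm, fun v hv => Submodule.projection_apply_of_mem_left _ hv,
    fun v hv => ?_⟩
  have hvT : v ∈ (U ⊓ W) ⊔ T := by
    rw [hT.sup_eq_top]
    trivial
  obtain ⟨u, hu, t, ht, rfl⟩ := Submodule.mem_sup.1 hvT
  have htW : t ∈ W := by
    have := W.sub_mem hv hu.2
    rwa [add_sub_cancel_left] at this
  rw [map_add, Submodule.projection_apply_of_mem_left _ hu.1,
    (Submodule.projection_apply_eq_zero_iff hCU.symm).2 (hC ⟨htW, ht⟩), add_zero]
  exact hu

theorem CayleyBacharach.form_eq_zero_of_residual {r : ℕ}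
    (h : CayleyBacharach r (Γ : Set (ProjSpace K n)))
    (hUW : ∀ x ∈ Γ, x.rep ∈ U ∨ x.rep ∈ W) {f : (Fin (n + 1) → K) → K} (hf : IsForm r f)
    (hf0 : ∀ v ∈ U ⊓ W, f v = 0) {x : ProjSpace K n} (hx : x ∈ offPart Γ W)
    (h0 : ∀ y ∈ offPart Γ W, y ≠ x → f y.rep = 0) : f x.rep = 0 := by
  obtain ⟨φ, hφU, hφW⟩ := exists_retraction U W
  rw [mem_offPart] at hx
  have h1 := h.form_eq_zero (hf.comp_linearMap φ) hx.1 fun y hy hyx => by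
    by_cases hyW : y.rep ∈ W
    · exact hf0 _ (hφW _ hyW)
    · rw [hφU _ ((hUW y hy).resolve_right hyW)]
      exact h0 y (mem_offPart.2 ⟨hy, hyW⟩) hyx
  rwa [hφU _ ((hUW x hx.1).resolve_right hx.2)] at h1

theorem offPart_eq_onPart_of_disjoint (hUW : ∀ x ∈ Γ, x.rep ∈ U ∨ x.rep ∈ W)
    (hd : U ⊓ W = ⊥) : offPart Γ W = onPart Γ U := by
  ext x
  rw [mem_offPart, mem_onPart]
  refine ⟨fun hx => ⟨hx.1, (hUW x hx.1).resolve_right hx.2⟩, fun hx => ⟨hx.1, fun hxW => ?_⟩⟩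
  have h : x.rep ∈ U ⊓ W := ⟨hx.2, hxW⟩
  rw [hd] at h
  exact x.rep_nonzero h

/-- If `Γ` lies on two disjoint linear spaces then its points on either of them inherit `CB(r)`. -/
theorem CayleyBacharach.onPart_of_disjoint {r : ℕ} (hr : 1 ≤ r)
    (h : CayleyBacharach r (Γ : Set (ProjSpace K n)))
    (hUW : ∀ x ∈ Γ, x.rep ∈ U ∨ x.rep ∈ W) (hd : U ⊓ W = ⊥) :
    CayleyBacharach r (onPart Γ U : Set (ProjSpace K n)) := by
  rw [← offPart_eq_onPart_of_disjoint hUW hd]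
  refine cayleyBacharach_of_forms fun f hf x hx h0 =>
    h.form_eq_zero_of_residual hUW hf (fun v hv => ?_) hx h0
  rw [hd, Submodule.mem_bot] at hv
  rw [hv, hf.map_zero hr]

open Classical in
/-- If `Γ` lies on two linear spaces meeting in at most a point `q`, then its points off the second
one inherit `CB(r)`, possibly after adding `q`. -/
theorem CayleyBacharach.residual {r : ℕ} (hr : 1 ≤ r)
    (h : CayleyBacharach r (Γ : Set (ProjSpace K n)))
    (hUW : ∀ x ∈ Γ, x.rep ∈ U ∨ x.rep ∈ W) (hd : Module.finrank K ↥(U ⊓ W) ≤ 1) :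
    CayleyBacharach r (offPart Γ W : Set (ProjSpace K n)) ∨
      ∃ q : ProjSpace K n, q.rep ∈ U ∧ q.rep ∈ W ∧
        CayleyBacharach r ((insert q (offPart Γ W) : Finset _) : Set (ProjSpace K n)) := by
  by_cases hbot : U ⊓ W = ⊥
  · left
    rw [offPart_eq_onPart_of_disjoint hUW hbot]
    exact h.onPart_of_disjoint hr hUW hbot
  obtain ⟨v, hv, hv0⟩ := Submodule.exists_mem_ne_zero_of_ne_bot hbot
  have hspan : ∀ w ∈ U ⊓ W, ∃ c : K, w = c • v := fun w hw => by
    obtain ⟨c, hc⟩ := (finrank_le_one_iff.1 hd).imp fun u hu => hu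
    obtain ⟨a, ha⟩ := hc ⟨v, hv⟩
    obtain ⟨b, hb⟩ := hc ⟨w, hw⟩
    have ha' : a • (c : Fin (n + 1) → K) = v := congrArg Subtype.val ha
    have hb' : b • (c : Fin (n + 1) → K) = w := congrArg Subtype.val hb
    have ha0 : a ≠ 0 := fun h => hv0 (by rw [← ha', h, zero_smul])
    exact ⟨b * a⁻¹, by rw [← ha', smul_smul, inv_mul_cancel_right₀ ha0, hb']⟩
  set q := Projectivization.mk K v hv0 with hq
  obtain ⟨a, ha⟩ := Projectivization.exists_smul_eq_mk_rep K v hv0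
  rw [← hq] at ha
  have hqUW : q.rep ∈ U ⊓ W := by
    rw [← ha]
    exact Submodule.smul_mem _ (a : K) hv
  have hzero : ∀ f : (Fin (n + 1) → K) → K, IsForm r f → f q.rep = 0 →
      ∀ w ∈ U ⊓ W, f w = 0 := fun f hf hfq w hw => by
    obtain ⟨c, rfl⟩ := hspan w hw
    rw [← ha, Units.smul_def, hf.map_smul] at hfq
    rw [hf.map_smul, (mul_eq_zero.1 hfq).resolve_left (pow_ne_zero _ a.ne_zero), mul_zero]
  -- If some `g` separates `q` from the residual points, a multiple of it corrects any test form to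
  -- vanish at `q` without changing its residual values. If there is none, vanishing at the residual
  -- points forces vanishing at `q`, so `q` may join the set.
  by_cases hg : ∃ g : (Fin (n + 1) → K) → K, IsForm r g ∧ (∀ y ∈ offPart Γ W, g y.rep = 0) ∧
      g q.rep ≠ 0
  · left
    obtain ⟨g, hgf, hg0, hgq⟩ := hg
    refine cayleyBacharach_of_forms fun f hf x hx h0 => ?_
    have hk := hf.sub (hgf.const_mul (f q.rep / g q.rep))
    have := h.form_eq_zero_of_residual hUW hk (hzero _ hk ?_) hx ?_
    · simpa [hg0 x hx] using this
    · field_simp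
      simp
    · intro y hy hyx
      simp [hg0 y hy, h0 y hy hyx]
  · right
    refine ⟨q, hqUW.1, hqUW.2, cayleyBacharach_of_forms fun f hf x hx h0 => ?_⟩
    push Not at hg
    have hqW : q ∉ offPart Γ W := fun hqm => (mem_offPart.1 hqm).2 hqUW.2
    rw [Finset.mem_coe, Finset.mem_insert] at hx
    rcases hx with rfl | hx
    · exact hg f hf fun y hy => h0 y (by simp [hy]) fun hyq => hqW (hyq ▸ hy)
    · exact h.form_eq_zero_of_residual hUW hf
        (hzero _ hf (h0 q (by simp) fun hqx => hqW (hqx ▸ hx))) hx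
        fun y hy hyx => h0 y (by simp [hy]) hyx

end Residual

/-! ### Configurations of dimension at most three -/

section LowDimension

variable {K : Type*} [Field K] {n : ℕ}
variable {Γ Δ : Finset (ProjSpace K n)} {U W : Submodule K (Fin (n + 1) → K)}

/-- `Γ` lies on two linear spaces of (linear) dimension at most `a` and `b`. -/
def OnTwo (a b : ℕ) (Γ : Finset (ProjSpace K n)) : Prop :=
  ∃ U W : Submodule K (Fin (n + 1) → K), Module.finrank K U ≤ a ∧ Module.finrank K W ≤ b ∧
    ∀ x ∈ Γ, x.rep ∈ U ∨ x.rep ∈ W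

/-- `Γ` lies on three lines. -/
def OnThreeLines (Γ : Finset (ProjSpace K n)) : Prop :=
  ∃ U V W : Submodule K (Fin (n + 1) → K), Module.finrank K U ≤ 2 ∧ Module.finrank K V ≤ 2 ∧
    Module.finrank K W ≤ 2 ∧ ∀ x ∈ Γ, x.rep ∈ U ∨ x.rep ∈ V ∨ x.rep ∈ W

theorem nonempty_of_prank_pos (h : 1 ≤ prank Γ) : Γ.Nonempty :=
  Finset.card_pos.1 (h.trans (prank_le_card Γ))

theorem offPart_nonempty (h : Module.finrank K U < prank Γ) : (offPart Γ U).Nonempty := by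
  obtain ⟨x, hx, hxU⟩ := exists_rep_notMem h
  exact ⟨x, mem_offPart.2 ⟨hx, hxU⟩⟩

theorem mem_or_mem_pspan_offPart (Γ : Finset (ProjSpace K n))
    (W : Submodule K (Fin (n + 1) → K)) :
    ∀ x ∈ Γ, x.rep ∈ W ∨ x.rep ∈ pspan (offPart Γ W) := fun x hx => by
  by_cases h : x.rep ∈ W
  · exact Or.inl h
  · exact Or.inr (rep_mem_pspan (mem_offPart.2 ⟨hx, h⟩))

theorem card_offPart_le_card_onPart_pspan (Γ : Finset (ProjSpace K n))
    (W : Submodule K (Fin (n + 1) → K)) :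
    (offPart Γ W).card ≤ (onPart Γ (pspan (offPart Γ W))).card :=
  card_le_card_onPart offPart_subset fun _ hx => rep_mem_pspan hx

theorem CayleyBacharach.prank_le_of_le_two {r d : ℕ} (hr : r ≤ 2)
    (h : CayleyBacharach r (Γ : Set (ProjSpace K n))) (hc : Γ.card ≤ (d + 1) * r + 1) :
    prank Γ ≤ d + 1 := by
  have h0 := prank_le_card Γ
  rcases Γ.eq_empty_or_nonempty with rfl | hΓ
  · rw [Finset.card_empty] at h0
    omega
  interval_cases r
  · omega
  · have := h.prank_lt_card hΓ
    omega
  · have := h.two_mul_prank_le_card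
    omega

/-- A best line `W` catches at least two points, so by induction the rest is collinear. It has at
least `r + 2` points in the induction step, and by maximality so does `W`, for a total of at least
`2r + 4`, exceeding `2(r + 1) + 1`. -/
theorem CayleyBacharach.prank_le_two {r : ℕ} (h : CayleyBacharach r (Γ : Set (ProjSpace K n)))
    (hc : Γ.card ≤ 2 * r + 1) : prank Γ ≤ 2 := by
  induction r generalizing Γ with
  | zero => exact (prank_le_card Γ).trans (by omega)
  | succ r ih =>
    by_contra! hlt
    obtain ⟨W, hW, hWc, hmax⟩ := exists_maximal_onPart (Γ := Γ) (j := 2) (by omega)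
    have hcb := h.remove W
    have h1 := hcb.add_two_le_card (offPart_nonempty (by omega))
    have h2 := card_onPart_add_card_offPart Γ W
    have h3 := ih hcb (by omega)
    have h4 := hmax (pspan (offPart Γ W)) h3
    have h5 := card_offPart_le_card_onPart_pspan Γ W
    rw [← prank] at h4
    omega

theorem CayleyBacharach.two_mul_add_two_le_card {r : ℕ}
    (h : CayleyBacharach r (Γ : Set (ProjSpace K n))) (hΓ : 3 ≤ prank Γ) :
    2 * r + 2 ≤ Γ.card := by
  by_contra! hlt
  have := h.prank_le_two (by omega)
  omega

theorem finrank_inf_le_one (hW : Module.finrank K W ≤ 2) (h : ∃ x ∈ Γ, x.rep ∉ U)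
    (hUW : ∀ x ∈ Γ, x.rep ∈ U ∨ x.rep ∈ W) : Module.finrank K ↥(U ⊓ W) ≤ 1 := by
  obtain ⟨x, hx, hxU⟩ := h
  have h1 : U ⊓ W < W := lt_of_le_of_ne inf_le_right fun he =>
    hxU (he.ge ((hUW x hx).resolve_left hxU)).1
  have h2 := Submodule.finrank_lt_finrank_of_lt h1
  omega

/-- The points off `U` all lie on `W` and have `CB(r)`, so discarding `W` loses at least `r + 2`
points. Only an added meeting point `q` can give one back; the final alternative records this for
use when the count is tight. -/
theorem CayleyBacharach.residual_line {r : ℕ}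
    (h : CayleyBacharach (r + 1) (Γ : Set (ProjSpace K n)))
    (hUW : ∀ x ∈ Γ, x.rep ∈ U ∨ x.rep ∈ W) (hW : Module.finrank K W ≤ 2)
    (hU : ∃ x ∈ Γ, x.rep ∉ U) :
    ∃ S : Finset (ProjSpace K n), CayleyBacharach (r + 1) (S : Set (ProjSpace K n)) ∧
      offPart Γ W ⊆ S ∧ S.card + r + 1 ≤ Γ.card ∧
      (S.card + r + 2 ≤ Γ.card ∨ ∃ q ∈ S, q.rep ∈ W) := by
  classical
  have h1 := finrank_inf_le_one hW hU hUW
  have h2 := (h.remove U).add_two_le_card (by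
    obtain ⟨x, hx, hxU⟩ := hU
    exact ⟨x, mem_offPart.2 ⟨hx, hxU⟩⟩)
  have h3 := card_le_card_onPart (Γ := Γ) (Δ := offPart Γ U) (U := W) offPart_subset
    fun x hx => (hUW x (mem_offPart.1 hx).1).resolve_left (mem_offPart.1 hx).2
  have h4 := card_onPart_add_card_offPart Γ W
  rcases h.residual (by omega) hUW h1 with h5 | ⟨q, -, hq, h5⟩
  · exact ⟨_, h5, subset_rfl, by omega, Or.inl (by omega)⟩
  · have := Finset.card_insert_le q (offPart Γ W)
    exact ⟨_, h5, Finset.subset_insert _ _, by omega,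
      Or.inr ⟨q, Finset.mem_insert_self _ _, hq⟩⟩

/-- On two disjoint linear spaces of complementary dimension in the span of `Γ`, both parts of `Γ`
span and inherit `CB(r)`. -/
theorem CayleyBacharach.skew {r : ℕ} (hr : 1 ≤ r)
    (h : CayleyBacharach r (Γ : Set (ProjSpace K n)))
    (hUW : ∀ x ∈ Γ, x.rep ∈ U ∨ x.rep ∈ W)
    (hd : Module.finrank K U + Module.finrank K W ≤ prank Γ) :
    CayleyBacharach r (onPart Γ U : Set (ProjSpace K n)) ∧
    CayleyBacharach r (onPart Γ W : Set (ProjSpace K n)) ∧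
    prank (onPart Γ U) = Module.finrank K U ∧ prank (onPart Γ W) = Module.finrank K W ∧
    (onPart Γ U).card + (onPart Γ W).card = Γ.card := by
  have h1 : prank Γ ≤ Module.finrank K ↥(U ⊔ W) := prank_le_finrank fun x hx =>
    (hUW x hx).elim (fun h => Submodule.mem_sup_left h) fun h => Submodule.mem_sup_right h
  have hbot : U ⊓ W = ⊥ := inf_eq_bot_of_finrank (by omega)
  have h2 : prank Γ ≤ prank (onPart Γ U) + prank (onPart Γ W) :=
    (prank_le_finrank fun x hx => (hUW x hx).elim
      (fun h => Submodule.mem_sup_left (rep_mem_pspan (mem_onPart.2 ⟨hx, h⟩)))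
      fun h => Submodule.mem_sup_right (rep_mem_pspan (mem_onPart.2 ⟨hx, h⟩))).trans
      (finrank_sup_le _ _)
  have h3 : prank (onPart Γ U) ≤ Module.finrank K U :=
    prank_le_finrank fun x hx => (mem_onPart.1 hx).2
  have h4 : prank (onPart Γ W) ≤ Module.finrank K W :=
    prank_le_finrank fun x hx => (mem_onPart.1 hx).2
  have h5 := card_onPart_add_card_offPart Γ W
  rw [offPart_eq_onPart_of_disjoint hUW hbot] at h5
  exact ⟨h.onPart_of_disjoint hr hUW hbot,
    h.onPart_of_disjoint hr (fun x hx => (hUW x hx).symm) (by rw [inf_comm, hbot]),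
    by omega, by omega, by omega⟩

theorem CayleyBacharach.skew_lines {r : ℕ} (hr : 1 ≤ r)
    (h : CayleyBacharach r (Γ : Set (ProjSpace K n)))
    (hUW : ∀ x ∈ Γ, x.rep ∈ U ∨ x.rep ∈ W) (hU : Module.finrank K U ≤ 2)
    (hW : Module.finrank K W ≤ 2) (hd : 4 ≤ prank Γ) :
    r + 2 ≤ (onPart Γ U).card ∧ r + 2 ≤ (onPart Γ W).card ∧
      (onPart Γ U).card + (onPart Γ W).card = Γ.card := by
  obtain ⟨h1, h2, h3, h4, h5⟩ := h.skew hr hUW (by omega)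
  have h6 : prank Γ ≤ Module.finrank K ↥(U ⊔ W) := prank_le_finrank fun x hx =>
    (hUW x hx).elim (fun h => Submodule.mem_sup_left h) fun h => Submodule.mem_sup_right h
  have h7 := finrank_sup_le U W
  exact ⟨h1.add_two_le_card (nonempty_of_prank_pos (by omega)),
    h2.add_two_le_card (nonempty_of_prank_pos (by omega)), h5⟩

theorem CayleyBacharach.skew_plane_line {r : ℕ} (hr : 1 ≤ r)
    (h : CayleyBacharach r (Γ : Set (ProjSpace K n)))
    (hUW : ∀ x ∈ Γ, x.rep ∈ U ∨ x.rep ∈ W) (hU : Module.finrank K U ≤ 3)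
    (hW : Module.finrank K W ≤ 2) (hd : 5 ≤ prank Γ) :
    2 * r + 2 ≤ (onPart Γ U).card ∧ r + 2 ≤ (onPart Γ W).card ∧
      (onPart Γ U).card + (onPart Γ W).card = Γ.card := by
  obtain ⟨h1, h2, h3, h4, h5⟩ := h.skew hr hUW (by omega)
  have h6 : prank Γ ≤ Module.finrank K ↥(U ⊔ W) := prank_le_finrank fun x hx =>
    (hUW x hx).elim (fun h => Submodule.mem_sup_left h) fun h => Submodule.mem_sup_right h
  have h7 := finrank_sup_le U W
  exact ⟨h1.two_mul_add_two_le_card (by omega),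
    h2.add_two_le_card (nonempty_of_prank_pos (by omega)), h5⟩

/-- At most `3r + 1` points with `CB(r)` lie on a plane or on two lines. -/
theorem CayleyBacharach.plane_or_two_lines {r : ℕ}
    (h : CayleyBacharach r (Γ : Set (ProjSpace K n))) (hc : Γ.card ≤ 3 * r + 1) :
    prank Γ ≤ 3 ∨ OnTwo 2 2 Γ := by
  induction r generalizing Γ with
  | zero => exact Or.inl (h.prank_le_of_le_two (d := 2) (by omega) (by omega))
  | succ r ih =>
    rcases Nat.eq_zero_or_pos r with rfl | hr
    · exact Or.inl (h.prank_le_of_le_two (d := 2) (by omega) (by omega))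
    by_contra! hlt
    obtain ⟨W, hW, hWc, hmax⟩ := exists_maximal_onPart (Γ := Γ) (j := 3) (by omega)
    have hcb := h.remove W
    have h2 := card_onPart_add_card_offPart Γ W
    have h3 := card_offPart_le_card_onPart_pspan Γ W
    rcases Nat.lt_or_ge (prank (offPart Γ W)) 3 with h4 | h4
    -- The residual set is collinear. Discarding its line leaves at most `2(r + 1) + 1` points in
    -- degree `r + 1`, which are again collinear.
    · obtain ⟨S, hS, hsub, hSc, -⟩ := h.residual_line (mem_or_mem_pspan_offPart Γ W)
        (Nat.lt_succ_iff.1 h4) (exists_rep_notMem (by omega))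
      refine hlt.2 ⟨pspan S, pspan (offPart Γ W), hS.prank_le_two (by omega),
        Nat.lt_succ_iff.1 h4, fun x hx => ?_⟩
      by_cases hxW : x.rep ∈ pspan (offPart Γ W)
      · exact Or.inr hxW
      · exact Or.inl (rep_mem_pspan (hsub (mem_offPart.2 ⟨hx, hxW⟩)))
    have h5 := hcb.two_mul_add_two_le_card h4
    rcases Nat.lt_or_ge (prank (offPart Γ W)) 4 with h6 | h6
    · have h7 := hmax (pspan (offPart Γ W)) (Nat.lt_succ_iff.1 h6)
      rw [← prank] at h7
      omega
    -- The residual set spans at least a three-space, so its two lines are skew with at least `r +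
    -- 2` points each. A plane through one of them has another point of `Γ`, so `W` has at least `r
    -- + 3`.
    · obtain ⟨U, V, hU, hV, hUV⟩ := (ih hcb (by omega)).resolve_left (by omega)
      obtain ⟨h7, h8, h9⟩ := hcb.skew_lines hr hUV hU hV h6
      have h10 := hmax U (by omega)
      have h11 := card_le_card_onPart (Γ := Γ) (Δ := onPart (offPart Γ W) U) (U := U)
        (onPart_subset.trans offPart_subset) fun x hx => (mem_onPart.1 hx).2
      omega

/-- For `r ≥ 2`, `2r + 3 ≤ 3r + 1`, so a smaller set would lie on two lines; these are skew and
carry `r + 2` points each. -/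
theorem CayleyBacharach.two_mul_add_four_le_card {r : ℕ} (hr : 2 ≤ r)
    (h : CayleyBacharach r (Γ : Set (ProjSpace K n))) (hΓ : 4 ≤ prank Γ) :
    2 * r + 4 ≤ Γ.card := by
  by_contra! hlt
  obtain ⟨U, V, hU, hV, hUV⟩ := (h.plane_or_two_lines (by omega)).resolve_left (by omega)
  have := h.skew_lines (by omega) hUV hU hV hΓ
  omega

theorem inf_eq_bot_of_forall_rep (h : ∀ x : ProjSpace K n, x.rep ∈ U → x.rep ∉ W) :
    U ⊓ W = ⊥ := by
  by_contra hne
  obtain ⟨v, hv, hv0⟩ := Submodule.exists_mem_ne_zero_of_ne_bot hne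
  obtain ⟨a, ha⟩ := Projectivization.exists_smul_eq_mk_rep K v hv0
  refine h (Projectivization.mk K v hv0) ?_ ?_ <;> rw [← ha]
  · exact U.smul_mem (a : K) hv.1
  · exact W.smul_mem (a : K) hv.2

theorem rep_notMem_of_inf_eq_bot {x : ProjSpace K n} (h : U ⊓ W = ⊥) (hx : x.rep ∈ U) :
    x.rep ∉ W := fun hxW => by
  have h1 : x.rep ∈ U ⊓ W := ⟨hx, hxW⟩
  rw [h] at h1
  exact x.rep_nonzero h1

theorem disjoint_onPart (h : U ⊓ W = ⊥) : Disjoint (onPart Γ U) (onPart Γ W) :=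
  Finset.disjoint_left.2 fun _ hx hy =>
    rep_notMem_of_inf_eq_bot h (mem_onPart.1 hx).2 (mem_onPart.1 hy).2

theorem card_onPart_add_le_of_inf_eq_bot (h : U ⊓ W = ⊥) :
    (onPart Γ U).card + (onPart Γ W).card ≤ (onPart Γ (U ⊔ W)).card := by
  classical
  rw [← Finset.card_union_of_disjoint (disjoint_onPart h)]
  exact Finset.card_le_card (Finset.union_subset (onPart_subset_onPart le_sup_left)
    (onPart_subset_onPart le_sup_right))

/-! ### Points on three lines -/

section ThreeLines

variable {L₁ L₂ L₃ : Submodule K (Fin (n + 1) → K)}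

/-- Two meeting lines span at most a plane, which with the third line would be a forbidden
configuration. -/
theorem inf_eq_bot_of_not_onTwo (h₁ : Module.finrank K L₁ ≤ 2) (h₂ : Module.finrank K L₂ ≤ 2)
    (h₃ : Module.finrank K L₃ ≤ 2)
    (hc : ∀ x ∈ Γ, x.rep ∈ L₁ ∨ x.rep ∈ L₂ ∨ x.rep ∈ L₃) (hn : ¬ OnTwo 3 2 Γ) :
    L₁ ⊓ L₂ = ⊥ := by
  refine inf_eq_bot_of_forall_rep fun q hq₁ hq₂ => hn ⟨L₁ ⊔ L₂, L₃, ?_, h₃, fun x hx => ?_⟩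
  · have := finrank_sup_lt_of_rep_mem hq₁ hq₂
    omega
  · rcases hc x hx with h | h | h
    · exact Or.inl (Submodule.mem_sup_left h)
    · exact Or.inl (Submodule.mem_sup_right h)
    · exact Or.inr h

/-- Discard `L₃` first, keeping the degree. With no extra point, the part on `L₁` inherits `CB(r +
1)`, since `L₁` and `L₂` are skew. With an extra point `q` on `L₃`, removing `L₂` costs a degree and
leaves points of `L₁` together with `q`. This set is not collinear, so it has at least `2r + 2`
points, all but one on `L₁`. -/
theorem CayleyBacharach.three_lines_card {r : ℕ} (hr : 1 ≤ r)
    (h : CayleyBacharach (r + 1) (Γ : Set (ProjSpace K n)))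
    (h₁ : Module.finrank K L₁ ≤ 2) (h₂ : Module.finrank K L₂ ≤ 2)
    (h₃ : Module.finrank K L₃ ≤ 2)
    (hc : ∀ x ∈ Γ, x.rep ∈ L₁ ∨ x.rep ∈ L₂ ∨ x.rep ∈ L₃) (hn : ¬ OnTwo 3 2 Γ)
    (hΓ : 5 ≤ prank Γ) :
    r + 3 ≤ (onPart Γ L₁).card ∨ 2 * r + 1 ≤ (onPart Γ L₁).card := by
  classical
  have h12 : L₁ ⊓ L₂ = ⊥ := inf_eq_bot_of_not_onTwo h₁ h₂ h₃ hc hn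
  have h13 : L₁ ⊓ L₃ = ⊥ := inf_eq_bot_of_not_onTwo h₁ h₃ h₂
    (fun x hx => by have := hc x hx; tauto) hn
  have h23 : L₂ ⊓ L₃ = ⊥ := inf_eq_bot_of_not_onTwo h₂ h₃ h₁
    (fun x hx => by have := hc x hx; tauto) hn
  have hcov : ∀ x ∈ Γ, x.rep ∈ L₁ ⊔ L₂ ∨ x.rep ∈ L₃ := fun x hx => by
    rcases hc x hx with h | h | h
    · exact Or.inl (Submodule.mem_sup_left h)
    · exact Or.inl (Submodule.mem_sup_right h)
    · exact Or.inr h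
  have hsup := finrank_sup_le L₁ L₂
  rcases h.residual (by omega) hcov
    (finrank_inf_le_one h₃ (exists_rep_notMem (by omega)) hcov) with hS | ⟨q, -, hq, hS⟩
  · left
    have hc' : ∀ x ∈ offPart Γ L₃, x.rep ∈ L₁ ∨ x.rep ∈ L₂ := fun x hx => by
      rw [mem_offPart] at hx
      have := hc x hx.1
      tauto
    have h4 := (hS.onPart_of_disjoint (by omega) hc' h12).add_two_le_card (by
      by_contra hne
      rw [Finset.not_nonempty_iff_eq_empty] at hne
      refine hn ⟨L₂, L₃, by omega, h₃, fun x hx => ?_⟩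
      by_contra! hx'
      have : x ∈ onPart (offPart Γ L₃) L₁ := by
        have := hc x hx
        simp only [mem_onPart, mem_offPart]
        tauto
      rw [hne] at this
      simp at this)
    have h5 := card_le_card_onPart (Γ := Γ) (Δ := onPart (offPart Γ L₃) L₁) (U := L₁)
      (onPart_subset.trans offPart_subset) fun x hx => (mem_onPart.1 hx).2
    omega
  · right
    set T := offPart (insert q (offPart Γ L₃)) L₂ with hT
    have hq2 : q.rep ∉ L₂ := fun hq2 => rep_notMem_of_inf_eq_bot h23 hq2 hq
    have hq1 : q.rep ∉ L₁ := fun hq1 => rep_notMem_of_inf_eq_bot h13 hq1 hq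
    have hqT : q ∈ T := mem_offPart.2 ⟨Finset.mem_insert_self _ _, hq2⟩
    have hTcb : CayleyBacharach r (T : Set (ProjSpace K n)) := hS.remove L₂
    have hTe : ∀ x ∈ T.erase q, x ∈ Γ ∧ x.rep ∈ L₁ := fun x hx => by
      simp only [hT, Finset.mem_erase, mem_offPart, Finset.mem_insert] at hx
      have h5 := hx.2.1.resolve_left hx.1
      have := hc x h5.1
      tauto
    have h4 := hTcb.add_two_le_card ⟨q, hqT⟩
    have h5 := Finset.card_erase_add_one hqT
    have h6 := card_le_card_onPart (Γ := Γ) (Δ := T.erase q) (U := L₁)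
      (fun x hx => (hTe x hx).1) fun x hx => (hTe x hx).2
    have h7 : 3 ≤ prank T := by
      by_contra! hlt
      have h8 : 2 ≤ prank (T.erase q) := by
        by_contra! hlt'
        have := card_le_one_of_finrank_le_one (Γ := T.erase q) (U := pspan (T.erase q))
          (Nat.lt_succ_iff.1 hlt') fun x hx => rep_mem_pspan hx
        omega
      have h9 : pspan (T.erase q) = pspan T := Submodule.eq_of_le_of_finrank_le
        (pspan_le.2 fun x hx => rep_mem_pspan (Finset.mem_of_mem_erase hx))
        ((Nat.lt_succ_iff.1 hlt).trans h8)
      have h10 : pspan (T.erase q) ≤ L₁ := pspan_le.2 fun x hx => (hTe x hx).2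
      exact hq1 (h10 (h9 ▸ rep_mem_pspan hqT))
    have h8 := hTcb.two_mul_add_two_le_card h7
    omega

theorem CayleyBacharach.three_lines {r : ℕ} (hr : 1 ≤ r)
    (h : CayleyBacharach (r + 1) (Γ : Set (ProjSpace K n)))
    (h₁ : Module.finrank K L₁ ≤ 2) (h₂ : Module.finrank K L₂ ≤ 2)
    (h₃ : Module.finrank K L₃ ≤ 2)
    (hc : ∀ x ∈ Γ, x.rep ∈ L₁ ∨ x.rep ∈ L₂ ∨ x.rep ∈ L₃) (hn : ¬ OnTwo 3 2 Γ)
    (hΓ : 5 ≤ prank Γ) :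
    3 * min (r + 3) (2 * r + 1) ≤ Γ.card ∧
      2 * min (r + 3) (2 * r + 1) ≤ (onPart Γ (L₁ ⊔ L₂)).card := by
  classical
  have hc' : ∀ x ∈ Γ, x.rep ∈ L₂ ∨ x.rep ∈ L₁ ∨ x.rep ∈ L₃ := fun x hx => by
    have := hc x hx
    tauto
  have hc'' : ∀ x ∈ Γ, x.rep ∈ L₃ ∨ x.rep ∈ L₁ ∨ x.rep ∈ L₂ := fun x hx => by
    have := hc x hx
    tauto
  have c1 := h.three_lines_card hr h₁ h₂ h₃ hc hn hΓ
  have c2 := h.three_lines_card hr h₂ h₁ h₃ hc' hn hΓ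
  have c3 := h.three_lines_card hr h₃ h₁ h₂ hc'' hn hΓ
  have h12 : L₁ ⊓ L₂ = ⊥ := inf_eq_bot_of_not_onTwo h₁ h₂ h₃ hc hn
  have h31 : L₃ ⊓ L₁ = ⊥ := inf_eq_bot_of_not_onTwo h₃ h₁ h₂ hc'' hn
  have h32 : L₃ ⊓ L₂ = ⊥ := inf_eq_bot_of_not_onTwo h₃ h₂ h₁
    (fun x hx => by have := hc x hx; tauto) hn
  have h4 := card_onPart_add_le_of_inf_eq_bot (Γ := Γ) h12
  have h5 : ((onPart Γ L₁ ∪ onPart Γ L₂) ∪ onPart Γ L₃).card ≤ Γ.card :=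
    Finset.card_le_card (Finset.union_subset (Finset.union_subset onPart_subset onPart_subset)
      onPart_subset)
  rw [Finset.card_union_of_disjoint, Finset.card_union_of_disjoint (disjoint_onPart h12)] at h5
  · omega
  · exact Finset.disjoint_union_left.2 ⟨(disjoint_onPart h31).symm, (disjoint_onPart h32).symm⟩

end ThreeLines

/-- At most `4r + 1` points with `CB(r)` lie on a three-space, on a plane and a line, or on three
lines. -/
theorem CayleyBacharach.dim_three {r : ℕ}
    (h : CayleyBacharach r (Γ : Set (ProjSpace K n))) (hc : Γ.card ≤ 4 * r + 1) :
    prank Γ ≤ 4 ∨ OnTwo 3 2 Γ ∨ OnThreeLines Γ := by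
  induction r generalizing Γ with
  | zero => exact Or.inl (h.prank_le_of_le_two (d := 3) (by omega) (by omega))
  | succ r ih =>
    rcases Nat.lt_or_ge r 2 with hr | hr
    · exact Or.inl (h.prank_le_of_le_two (d := 3) (by omega) (by omega))
    by_contra! hlt
    obtain ⟨hrank, hn2, hn3⟩ := hlt
    obtain ⟨W, hW, hWc, hmax⟩ := exists_maximal_onPart (Γ := Γ) (j := 4) (by omega)
    have hcb := h.remove W
    have h2 := card_onPart_add_card_offPart Γ W
    have h3 := card_offPart_le_card_onPart_pspan Γ W
    rcases Nat.lt_or_ge (prank (offPart Γ W)) 3 with h4 | h4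
    · obtain ⟨S, hS, hsub, hSc, -⟩ := h.residual_line (mem_or_mem_pspan_offPart Γ W)
        (Nat.lt_succ_iff.1 h4) (exists_rep_notMem (by omega))
      have hcov : ∀ x ∈ Γ, x ∈ S ∨ x.rep ∈ pspan (offPart Γ W) := fun x hx => by
        by_cases hxW : x.rep ∈ pspan (offPart Γ W)
        · exact Or.inr hxW
        · exact Or.inl (hsub (mem_offPart.2 ⟨hx, hxW⟩))
      rcases hS.plane_or_two_lines (by omega) with h5 | ⟨U, V, hU, hV, hUV⟩
      · exact hn2 ⟨pspan S, _, h5, Nat.lt_succ_iff.1 h4, fun x hx =>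
          (hcov x hx).imp_left rep_mem_pspan⟩
      · refine hn3 ⟨U, V, _, hU, hV, Nat.lt_succ_iff.1 h4, fun x hx => ?_⟩
        rcases hcov x hx with h6 | h6
        · have := hUV x h6
          tauto
        · exact Or.inr (Or.inr h6)
    have h5 := hcb.two_mul_add_two_le_card h4
    rcases Nat.lt_or_ge (prank (offPart Γ W)) 5 with h6 | h6
    · have h7 := hmax (pspan (offPart Γ W)) (Nat.lt_succ_iff.1 h6)
      rw [← prank] at h7
      rcases Nat.lt_or_ge (prank (offPart Γ W)) 4 with h8 | h8
      -- Here the residual set spans a plane and the first count is tight: `2r + 2` points off `W`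
      -- and `2r + 3` on it. Removing that plane instead leaves `2r + 3` points, too few to have
      -- rank four, while rank at most three would give `W` a further point.
      · have h9 := card_onPart_add_card_offPart Γ (pspan (offPart Γ W))
        have h10 := h.remove (pspan (offPart Γ W))
        rcases Nat.lt_or_ge (prank (offPart Γ (pspan (offPart Γ W)))) 4 with h11 | h11
        · have h12 := hmax (pspan (offPart Γ (pspan (offPart Γ W)))) h11.le
          have h13 := card_offPart_le_card_onPart_pspan Γ (pspan (offPart Γ W))
          rw [← prank] at h12
          omega
        · have h12 := h10.two_mul_add_four_le_card hr h11
          omega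
      · have h9 := hcb.two_mul_add_four_le_card hr h8
        omega
    by_cases hn : OnTwo 3 2 (offPart Γ W)
    · obtain ⟨U, V, hU, hV, hUV⟩ := hn
      obtain ⟨h7, h8, h9⟩ := hcb.skew_plane_line (by omega) hUV hU hV h6
      have h10 := hmax U (by omega)
      have h11 := card_le_card_onPart (Γ := Γ) (Δ := onPart (offPart Γ W) U) (U := U)
        (onPart_subset.trans offPart_subset) fun x hx => (mem_onPart.1 hx).2
      omega
    · obtain ⟨L₁, L₂, L₃, h₁, h₂, h₃, hcov⟩ :=
        ((ih hcb (by omega)).resolve_left (by omega)).resolve_left hn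
      -- `W` has at least as many points as the span of two of the lines, hence five times the
      -- minimum count per line in total.
      obtain ⟨s, rfl⟩ : ∃ s, r = s + 1 := ⟨r - 1, by omega⟩
      obtain ⟨h7, h8⟩ := hcb.three_lines (by omega) h₁ h₂ h₃ hcov hn h6
      have h9 := finrank_sup_le L₁ L₂
      have h10 := hmax (L₁ ⊔ L₂) (by omega)
      have h11 := card_le_card_onPart (Γ := Γ) (Δ := onPart (offPart Γ W) (L₁ ⊔ L₂))
        (U := L₁ ⊔ L₂) (onPart_subset.trans offPart_subset) fun x hx => (mem_onPart.1 hx).2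
      omega

/-- For `r = 3, 4`, three pairwise skew lines would need at least 15, respectively 18, points,
against the bounds 13 and 17. -/
theorem CayleyBacharach.dim_three_short {r : ℕ} (hr : r ≤ 4)
    (h : CayleyBacharach r (Γ : Set (ProjSpace K n))) (hc : Γ.card ≤ 4 * r + 1) :
    prank Γ ≤ 4 ∨ OnTwo 3 2 Γ := by
  rcases Nat.lt_or_ge r 3 with hr' | hr'
  · exact Or.inl (h.prank_le_of_le_two (d := 3) (by omega) (by omega))
  by_contra! hlt
  obtain ⟨L₁, L₂, L₃, h₁, h₂, h₃, hcov⟩ :=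
    ((h.dim_three hc).resolve_left (by omega)).resolve_left hlt.2
  obtain ⟨s, rfl⟩ : ∃ s, r = s + 1 := ⟨r - 1, by omega⟩
  obtain ⟨h4, -⟩ := h.three_lines (by omega) h₁ h₂ h₃ hcov hlt.2 (by omega)
  omega

end LowDimension

/-! ### Sixteen points in degree three -/

section DimensionFour

variable {K : Type*} [Field K] {n : ℕ}
variable {Γ : Finset (ProjSpace K n)} {U W P : Submodule K (Fin (n + 1) → K)}

theorem rep_mem_sup_span_rep (U : Submodule K (Fin (n + 1) → K)) (x : ProjSpace K n) :
    x.rep ∈ U ⊔ Submodule.span K {x.rep} :=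
  Submodule.mem_sup_right (Submodule.mem_span_singleton_self _)

theorem finrank_sup_span_rep_le (U : Submodule K (Fin (n + 1) → K)) (x : ProjSpace K n) :
    Module.finrank K ↥(U ⊔ Submodule.span K {x.rep}) ≤ Module.finrank K U + 1 := by
  have h := finrank_sup_le U (Submodule.span K {x.rep})
  rwa [finrank_span_rep] at h

theorem prank_le_finrank_sup (hUW : ∀ x ∈ Γ, x.rep ∈ U ∨ x.rep ∈ W) :
    prank Γ ≤ Module.finrank K ↥(U ⊔ W) :=
  prank_le_finrank fun x hx =>
    (hUW x hx).elim (fun h => Submodule.mem_sup_left h) fun h => Submodule.mem_sup_right h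

theorem mem_offPart_or_mem {x : ProjSpace K n} (hx : x ∈ Γ) : x ∈ offPart Γ W ∨ x.rep ∈ W := by
  rw [mem_offPart]
  tauto

/-- By rank, `U` and `P` meet in at most a point. Without an extra point, nine points in degree
three have rank at most three. With `q` added there are at most `10 = 3 * 3 + 1`, on a plane or two
lines; in the latter case the line through `q` meets `P` and joins it to a three-space. -/
theorem CayleyBacharach.onTwo_of_space_plane
    (h : CayleyBacharach 3 (Γ : Set (ProjSpace K n))) (hΓ : 6 ≤ prank Γ)
    (hUP : ∀ x ∈ Γ, x.rep ∈ U ∨ x.rep ∈ P) (hU : Module.finrank K U ≤ 4)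
    (hP : Module.finrank K P ≤ 3) (hc : (offPart Γ P).card ≤ 9) :
    OnTwo 4 2 Γ ∨ OnTwo 3 3 Γ := by
  classical
  have h1 := prank_le_finrank_sup hUP
  have h2 := Submodule.finrank_sup_add_finrank_inf_eq U P
  rcases h.residual (by omega) hUP (by omega) with hS | ⟨q, -, hqP, hS⟩
  · right
    refine ⟨pspan (offPart Γ P), P, ?_, hP,
      fun x hx => (mem_offPart_or_mem hx).imp_left rep_mem_pspan⟩
    by_contra! hlt
    have := hS.two_mul_add_four_le_card (by omega) hlt
    omega
  · have h3 := Finset.card_insert_le q (offPart Γ P)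
    have hcov : ∀ x ∈ Γ, x ∈ insert q (offPart Γ P) ∨ x.rep ∈ P := fun x hx =>
      (mem_offPart_or_mem hx).imp_left Finset.mem_insert_of_mem
    rcases hS.plane_or_two_lines (by omega) with h4 | ⟨L, M, hL, hM, hLM⟩
    · exact Or.inr ⟨_, P, h4, hP, fun x hx => (hcov x hx).imp_left rep_mem_pspan⟩
    · left
      rcases hLM q (Finset.mem_insert_self _ _) with hq | hq
      · have := finrank_sup_lt_of_rep_mem hqP hq
        refine ⟨P ⊔ L, M, by omega, hM, fun x hx => ?_⟩
        rcases hcov x hx with hx | hx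
        · exact (hLM x hx).imp_left fun h => Submodule.mem_sup_right h
        · exact Or.inl (Submodule.mem_sup_left hx)
      · have := finrank_sup_lt_of_rep_mem hqP hq
        refine ⟨P ⊔ M, L, by omega, hL, fun x hx => ?_⟩
        rcases hcov x hx with hx | hx
        · exact (hLM x hx).symm.imp_left fun h => Submodule.mem_sup_right h
        · exact Or.inl (Submodule.mem_sup_left hx)

/-- Discarding the line leaves at most 13 points in degree three. If these span more than a
three-space, they lie on a plane and a line with at least `8 + 5` points, so the count is tight and
a point `q` on `W` was added. `W` then meets the plane or the line and is absorbed into it. -/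
theorem CayleyBacharach.onTwo_of_line
    (h : CayleyBacharach 3 (Γ : Set (ProjSpace K n))) (hΓ : Γ.card ≤ 16)
    (hUW : ∀ x ∈ Γ, x.rep ∈ U ∨ x.rep ∈ W) (hW : Module.finrank K W ≤ 2)
    (hU : ∃ x ∈ Γ, x.rep ∉ U) : OnTwo 4 2 Γ ∨ OnTwo 3 3 Γ := by
  obtain ⟨S, hS, hsub, hSc, hq⟩ := CayleyBacharach.residual_line (r := 2) h hUW hW hU
  have hcov : ∀ x ∈ Γ, x ∈ S ∨ x.rep ∈ W := fun x hx =>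
    (mem_offPart_or_mem hx).imp_left fun h => hsub h
  by_cases hSr : prank S ≤ 4
  · exact Or.inl ⟨pspan S, W, hSr, hW, fun x hx => (hcov x hx).imp_left rep_mem_pspan⟩
  obtain ⟨A, L, hA, hL, hAL⟩ := (hS.dim_three_short (by omega) (by omega)).resolve_left hSr
  obtain ⟨h1, h2, h3⟩ := hS.skew_plane_line (by omega) hAL hA hL (by omega)
  obtain ⟨q, hqS, hqW⟩ := hq.resolve_left (by omega)
  rcases hAL q hqS with hqA | hqL
  · have := finrank_sup_lt_of_rep_mem hqA hqW
    refine Or.inl ⟨A ⊔ W, L, by omega, hL, fun x hx => ?_⟩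
    rcases hcov x hx with hx | hx
    · exact (hAL x hx).imp_left fun h => Submodule.mem_sup_left h
    · exact Or.inl (Submodule.mem_sup_right hx)
  · have := finrank_sup_lt_of_rep_mem hqL hqW
    refine Or.inr ⟨A, L ⊔ W, hA, by omega, fun x hx => ?_⟩
    rcases hcov x hx with hx | hx
    · exact (hAL x hx).imp_right fun h => Submodule.mem_sup_left h
    · exact Or.inr (Submodule.mem_sup_right hx)

/-- If `Γ` consists of six points in a plane `P` and ten further points of rank at least five, and
no four-space contains more than ten points of `Γ`, then the points off some four-space are at least
six of these ten points and lie in a plane. -/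
theorem CayleyBacharach.exists_second_plane
    (h : CayleyBacharach 3 (Γ : Set (ProjSpace K n))) (hΓ : Γ.card = 16)
    (hP : Module.finrank K P ≤ 3) (hPc : (onPart Γ P).card = 6)
    (hr : 5 ≤ prank (offPart Γ P))
    (hmax : ∀ V : Submodule K (Fin (n + 1) → K), Module.finrank K V ≤ 5 →
      (onPart Γ V).card ≤ 10) :
    ∃ D ⊆ offPart Γ P, 6 ≤ D.card ∧ prank D ≤ 3 ∧
      ∃ V : Submodule K (Fin (n + 1) → K), Module.finrank K V ≤ 5 ∧ D = offPart Γ V := by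
  classical
  have h1 := card_onPart_add_card_offPart Γ P
  obtain ⟨B, hB, hBc, hBs⟩ := exists_basis_subset (offPart Γ P)
  have h2 := Finset.card_sdiff_add_card_eq_card hB
  have h3 := (h.remove P).two_mul_prank_le_card
  -- The ten points off `P` have `CB(2)`, hence rank five, so `a` and `b` can be chosen outside a
  -- basis `B`. At most eight points lie off `V`; if they had rank four, all eight would be needed,
  -- and they would contain `B`.
  obtain ⟨a, ha, b, hb, hab⟩ := Finset.one_lt_card.1 (by omega : 1 < (offPart Γ P \ B).card)
  rw [Finset.mem_sdiff] at ha hb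
  set V := P ⊔ Submodule.span K {a.rep} ⊔ Submodule.span K {b.rep} with hV
  have hVr : Module.finrank K V ≤ 5 := by
    have := finrank_sup_span_rep_le P a
    have := finrank_sup_span_rep_le (P ⊔ Submodule.span K {a.rep}) b
    rw [← hV] at this
    omega
  have h4 := card_onPart_add_card_offPart Γ V
  have h5 := hmax V hVr
  have haV : a.rep ∈ V := Submodule.mem_sup_left (rep_mem_sup_span_rep P a)
  have hbV : b.rep ∈ V := rep_mem_sup_span_rep _ b
  have hPV : P ≤ V := le_sup_left.trans le_sup_left
  have hsub : offPart Γ V ⊆ ((offPart Γ P).erase a).erase b := fun x hx => by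
    rw [mem_offPart] at hx
    simp only [Finset.mem_erase, mem_offPart]
    exact ⟨fun h => hx.2 (h ▸ hbV), fun h => hx.2 (h ▸ haV), hx.1, fun h => hx.2 (hPV h)⟩
  have h6 : (((offPart Γ P).erase a).erase b).card = 8 := by
    rw [Finset.card_erase_of_mem (Finset.mem_erase.2 ⟨hab.symm, hb.1⟩),
      Finset.card_erase_of_mem ha.1]
    omega
  have h7 := (h.remove V).two_mul_prank_le_card
  refine ⟨offPart Γ V, hsub.trans ((Finset.erase_subset _ _).trans (Finset.erase_subset _ _)),
    by omega, ?_, V, hVr, rfl⟩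
  by_contra! hlt
  have h8 := Finset.eq_of_subset_of_card_le hsub (by omega)
  have hBD : B ⊆ offPart Γ V := fun x hx => by
    rw [h8, Finset.mem_erase, Finset.mem_erase]
    exact ⟨fun h => hb.2 (h ▸ hx), fun h => ha.2 (h ▸ hx), hB hx⟩
  have h9 := prank_mono hBD
  have h10 : prank B = prank (offPart Γ P) := by rw [prank, hBs, prank]
  have h11 := Finset.card_le_card hsub
  omega

/-- Call the remaining four points `C`. Removing two spaces leaves a set with `CB(1)`, which is
empty or has at least three points. Applied to suitable pairs, this makes `C` lie in the span of `Q`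
and one point of `C`. -/
theorem CayleyBacharach.exists_two_planes_and_four_points
    {Q : Submodule K (Fin (n + 1) → K)}
    (h : CayleyBacharach 3 (Γ : Set (ProjSpace K n))) (hΓ : Γ.card = 16)
    (hP : Module.finrank K P ≤ 3) (hQ : Module.finrank K Q ≤ 3) (hPc : (onPart Γ P).card = 6)
    (hQc : (onPart Γ Q).card = 6) (hd : onPart Γ P ⊆ offPart Γ Q)
    (hr : 5 ≤ prank (offPart Γ Q)) :
    ∃ V : Submodule K (Fin (n + 1) → K), Module.finrank K V ≤ 4 ∧ 10 ≤ (onPart Γ V).card := by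
  classical
  have h1 := card_onPart_add_card_offPart Γ Q
  have h2 := card_onPart_add_card_offPart (offPart Γ Q) P
  set C := offPart (offPart Γ Q) P with hC
  have hCm : ∀ x, x ∈ C ↔ (x ∈ Γ ∧ x.rep ∉ Q) ∧ x.rep ∉ P := fun x => by
    rw [hC, mem_offPart, mem_offPart]
  have h3 : onPart (offPart Γ Q) P = onPart Γ P := by
    ext x
    rw [mem_onPart]
    exact ⟨fun hx => mem_onPart.2 ⟨offPart_subset hx.1, hx.2⟩,
      fun hx => ⟨hd hx, (mem_onPart.1 hx).2⟩⟩
  rw [h3] at h2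
  -- Otherwise removing `Q` and the span of `P` and `b` would leave at most two points, yet not
  -- none, as the points off `Q` have rank at least five.
  have key : ∀ b ∈ C, ∀ x ∈ C, x ≠ b → x.rep ∉ P ⊔ Submodule.span K {b.rep} := by
    intro b hb x hx hxb hxm
    have h4 := finrank_sup_span_rep_le P b
    have h5 := (h.remove Q).remove (P ⊔ Submodule.span K {b.rep})
    have h6 := h5.add_two_le_card (offPart_nonempty (by omega))
    have h7 : offPart (offPart Γ Q) (P ⊔ Submodule.span K {b.rep}) ⊆ (C.erase b).erase x := by
      intro y hy
      rw [mem_offPart] at hy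
      refine Finset.mem_erase.2 ⟨fun he => hy.2 (he ▸ hxm), Finset.mem_erase.2
        ⟨fun he => hy.2 (he ▸ rep_mem_sup_span_rep P b), ?_⟩⟩
      exact mem_offPart.2 ⟨hy.1, fun hyP => hy.2 (Submodule.mem_sup_left hyP)⟩
    have h8 := Finset.card_le_card h7
    rw [Finset.card_erase_of_mem (Finset.mem_erase.2 ⟨hxb, hx⟩), Finset.card_erase_of_mem hb] at h8
    omega
  obtain ⟨c, hc⟩ : C.Nonempty := Finset.card_pos.1 (by omega)
  have hVr := finrank_sup_span_rep_le Q c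
  set V := Q ⊔ Submodule.span K {c.rep} with hV
  have hCV : ∀ x ∈ C, x.rep ∈ V := by
    intro x hx
    by_cases hxc : x = c
    · exact hxc ▸ rep_mem_sup_span_rep Q c
    by_contra hxV
    have h4 : ((C.erase c).erase x).card = 2 := by
      rw [Finset.card_erase_of_mem (Finset.mem_erase.2 ⟨hxc, hx⟩), Finset.card_erase_of_mem hc]
      omega
    -- By `key`, `x` survives the removal of `V` and of the span of `P` and `b`, but only two points
    -- of `C` are available.
    obtain ⟨b, hb⟩ : ((C.erase c).erase x).Nonempty := Finset.card_pos.1 (by omega)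
    rw [Finset.mem_erase, Finset.mem_erase] at hb
    have h5 := ((h.remove V).remove (P ⊔ Submodule.span K {b.rep})).add_two_le_card
      ⟨x, mem_offPart.2 ⟨mem_offPart.2 ⟨((hCm x).1 hx).1.1, hxV⟩,
        key b hb.2.2 x hx (Ne.symm hb.1)⟩⟩
    have h6 : offPart (offPart Γ V) (P ⊔ Submodule.span K {b.rep}) ⊆ (C.erase c).erase b := by
      intro y hy
      rw [mem_offPart, mem_offPart] at hy
      refine Finset.mem_erase.2 ⟨fun he => hy.2 (he ▸ rep_mem_sup_span_rep P b), Finset.mem_erase.2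
        ⟨fun he => hy.1.2 (he ▸ rep_mem_sup_span_rep Q c), ?_⟩⟩
      exact (hCm y).2 ⟨⟨hy.1.1, fun hyQ => hy.1.2 (Submodule.mem_sup_left hyQ)⟩,
        fun hyP => hy.2 (Submodule.mem_sup_left hyP)⟩
    have h7 := Finset.card_le_card h6
    rw [Finset.card_erase_of_mem (Finset.mem_erase.2 ⟨hb.2.1, hb.2.2⟩),
      Finset.card_erase_of_mem hc] at h7
    omega
  refine ⟨V, by omega, ?_⟩
  have h4 : onPart Γ Q ∪ C ⊆ onPart Γ V := Finset.union_subset (onPart_subset_onPart le_sup_left)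
    fun x hx => mem_onPart.2 ⟨((hCm x).1 hx).1.1, hCV x hx⟩
  have h5 := Finset.card_le_card h4
  rw [Finset.card_union_of_disjoint (Finset.disjoint_left.2 fun x hx hxC =>
    ((hCm x).1 hxC).1.2 (mem_onPart.1 hx).2)] at h5
  omega

/-- At most sixteen points with `CB(3)` lie on a four-space, on a three-space and a line, or on two
planes. -/
theorem CayleyBacharach.dim_four (h : CayleyBacharach 3 (Γ : Set (ProjSpace K n)))
    (hΓ : Γ.card ≤ 16) : prank Γ ≤ 5 ∨ OnTwo 4 2 Γ ∨ OnTwo 3 3 Γ := by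
  by_cases hrank : prank Γ ≤ 5
  · exact Or.inl hrank
  right
  obtain ⟨W, hW, hWc, hmax⟩ := exists_maximal_onPart (Γ := Γ) (j := 5) (by omega)
  have h1 := card_onPart_add_card_offPart Γ W
  have h2 := (h.remove W).two_mul_prank_le_card
  have h3 := hmax (pspan (offPart Γ W)) (by rw [← prank]; omega)
  have h4 := card_offPart_le_card_onPart_pspan Γ W
  rw [← prank] at h3
  rcases Nat.lt_or_ge (prank (offPart Γ W)) 3 with h5 | h5
  · exact h.onTwo_of_line hΓ (mem_or_mem_pspan_offPart Γ W) (Nat.lt_succ_iff.1 h5)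
      (exists_rep_notMem (by omega))
  -- A residual set of rank `s` has at least `2s` points, and maximality gives `W` at least `s + 5`;
  -- the total `3s + 5` exceeds 16 once `s ≥ 4`.
  have hP : Module.finrank K (pspan (offPart Γ W)) ≤ 3 := by
    rw [← prank]
    omega
  have hoffP : offPart Γ W ⊆ onPart Γ (pspan (offPart Γ W)) := fun x hx =>
    mem_onPart.2 ⟨offPart_subset hx, rep_mem_pspan hx⟩
  generalize pspan (offPart Γ W) = P at *
  have h6 := card_onPart_add_card_offPart Γ P
  have h7 := (h.remove P).two_mul_prank_le_card
  have hcovP : ∀ x ∈ Γ, x.rep ∈ pspan (offPart Γ P) ∨ x.rep ∈ P := fun x hx =>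
    (mem_or_mem_pspan_offPart Γ P x hx).symm
  rcases Nat.lt_or_ge (prank (offPart Γ P)) 4 with h8 | h8
  · exact Or.inr ⟨_, P, Nat.lt_succ_iff.1 h8, hP, hcovP⟩
  rcases Nat.lt_or_ge (prank (offPart Γ P)) 5 with h9 | h9
  · have h10 := hmax (pspan (offPart Γ P)) h9.le
    have h11 := card_offPart_le_card_onPart_pspan Γ P
    rw [← prank] at h10
    exact h.onTwo_of_space_plane (by omega) hcovP (Nat.lt_succ_iff.1 h9) hP (by omega)
  obtain ⟨D, hDP, hDc, hDr, V, hVr, rfl⟩ := h.exists_second_plane (by omega) hP (by omega) h9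
    fun V hV => by
      have := hmax V hV
      omega
  -- All counts are now forced: ten points on `W`, and the six off `W` are exactly those on `P`.
  -- Hence the points off `P`, and the second plane they give, lie in `W`.
  have hoffP' := Finset.eq_of_subset_of_card_le hoffP (by omega)
  have hDW : pspan (offPart Γ V) ≤ W := pspan_le.2 fun x hx => by
    have hx' := mem_offPart.1 (hDP hx)
    by_contra hxW
    exact hx'.2 (mem_onPart.1 (hoffP (mem_offPart.2 ⟨hx'.1, hxW⟩))).2
  have hDQ := card_offPart_le_card_onPart_pspan Γ V
  have hQ : Module.finrank K (pspan (offPart Γ V)) ≤ 3 := hDr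
  generalize pspan (offPart Γ V) = Q at *
  have h10 := card_onPart_add_card_offPart Γ Q
  have h11 := (h.remove Q).two_mul_prank_le_card
  rcases Nat.lt_or_ge (prank (offPart Γ Q)) 5 with h12 | h12
  · have h13 := hmax (pspan (offPart Γ Q)) h12.le
    have h14 := card_offPart_le_card_onPart_pspan Γ Q
    rw [← prank] at h13
    exact h.onTwo_of_space_plane (by omega) (fun x hx => (mem_or_mem_pspan_offPart Γ Q x hx).symm)
      (Nat.lt_succ_iff.1 h12) hQ (by omega)
  obtain ⟨G, hG, hGc⟩ := h.exists_two_planes_and_four_points (by omega) hP hQ (by omega) (by omega)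
    (fun x hx => by
      rw [← hoffP', mem_offPart] at hx
      exact mem_offPart.2 ⟨hx.1, fun hxQ => hx.2 (hDW hxQ)⟩) h12
  -- A three-space with ten points extends to a four-space with eleven, while `W` has only ten.
  have h13 := hmax G (by omega)
  omega

end DimensionFour

/-! ### From subspaces to plane configurations -/

section Configurations

variable {K : Type*} [Field K] {n : ℕ}
variable {Γ : Finset (ProjSpace K n)} {U V W : Submodule K (Fin (n + 1) → K)}

theorem projDim_projectivization (U : Submodule K (Fin (n + 1) → K)) :
    projDim U.projectivization = Module.finrank K U - 1 := by
  rw [projDim, Submodule.projectivization, OrderIso.apply_symm_apply]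

theorem mem_projectivization_iff_rep {x : ProjSpace K n} :
    x ∈ U.projectivization ↔ x.rep ∈ U := by
  rw [Submodule.mem_projectivization_iff_submodule_le, Projectivization.submodule_eq,
    Submodule.span_singleton_le_iff_mem]

theorem exists_le_finrank_eq {j : ℕ} (hU : Module.finrank K U ≤ j) (hj : j ≤ n + 1) :
    ∃ W, U ≤ W ∧ Module.finrank K W = j := by
  induction hk : j - Module.finrank K U generalizing U with
  | zero => exact ⟨U, le_rfl, by omega⟩
  | succ k ih =>
    have hne : U ≠ ⊤ := fun h => by
      rw [h, finrank_top, Module.finrank_fin_fun] at hk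
      omega
    obtain ⟨v, -, hv⟩ := SetLike.exists_of_lt (lt_top_iff_ne_top.2 hne)
    have hv0 : v ≠ 0 := fun h => hv (h ▸ U.zero_mem)
    have h1 := finrank_sup_le U (Submodule.span K {v})
    have h2 : U < U ⊔ Submodule.span K {v} := lt_of_le_of_ne le_sup_left fun he =>
      hv (he ▸ Submodule.mem_sup_right (Submodule.mem_span_singleton_self v))
    have h3 := Submodule.finrank_lt_finrank_of_lt h2
    rw [finrank_span_singleton hv0] at h1
    obtain ⟨W, hW, hW'⟩ := ih (U := U ⊔ Submodule.span K {v}) (by omega) (by omega)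
    exact ⟨W, le_sup_left.trans hW, hW'⟩

/-- The plane configuration with given members. -/
noncomputable def configurationOf (s : Finset (Submodule K (Fin (n + 1) → K)))
    (hs : ∀ U ∈ s, 2 ≤ Module.finrank K U) : PlaneConfiguration K n where
  planes := s.map ⟨Submodule.projectivization, Submodule.projectivization.injective⟩
  projDim_pos P hP := by
    obtain ⟨U, hU, rfl⟩ := Finset.mem_map.1 hP
    have := hs U hU
    rw [Function.Embedding.coeFn_mk, projDim_projectivization]
    omega

theorem mem_carrier_configurationOf {s : Finset (Submodule K (Fin (n + 1) → K))}
    {hs : ∀ U ∈ s, 2 ≤ Module.finrank K U} {x : ProjSpace K n} :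
    x ∈ (configurationOf s hs).carrier ↔ ∃ U ∈ s, x.rep ∈ U := by
  simp [configurationOf, PlaneConfiguration.carrier, mem_projectivization_iff_rep]

theorem dim_configurationOf (s : Finset (Submodule K (Fin (n + 1) → K)))
    (hs : ∀ U ∈ s, 2 ≤ Module.finrank K U) :
    (configurationOf s hs).dim = ∑ U ∈ s, (Module.finrank K U - 1) := by
  simp [configurationOf, PlaneConfiguration.dim, projDim_projectivization]

theorem length_configurationOf (s : Finset (Submodule K (Fin (n + 1) → K)))
    (hs : ∀ U ∈ s, 2 ≤ Module.finrank K U) :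
    (configurationOf s hs).length = s.card := by
  simp [configurationOf, PlaneConfiguration.length]

theorem exists_configuration_empty :
    ∃ C : PlaneConfiguration K n, ((∅ : Finset (ProjSpace K n)) : Set (ProjSpace K n)) ⊆ C.carrier ∧
      C.dim = 0 ∧ C.length = 0 :=
  ⟨configurationOf ∅ (by simp), by simp, by simp [dim_configurationOf],
    by simp [length_configurationOf]⟩

theorem exists_configuration_of_prank {d : ℕ} (hd : 1 ≤ d) (hn : 1 ≤ n)
    (hΓ : prank Γ ≤ d + 1) :
    ∃ C : PlaneConfiguration K n, (Γ : Set (ProjSpace K n)) ⊆ C.carrier ∧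
      C.dim = min d n ∧ C.length = 1 := by
  have h1 : prank Γ ≤ n + 1 := (Submodule.finrank_le _).trans (by simp)
  obtain ⟨W, hW, hWr⟩ := exists_le_finrank_eq (U := pspan Γ) (j := min d n + 1)
    (by rw [← prank]; omega) (by omega)
  refine ⟨configurationOf {W} (by simp only [Finset.mem_singleton, forall_eq]; omega),
    fun x hx => mem_carrier_configurationOf.2 ⟨W, by simp, hW (rep_mem_pspan hx)⟩, ?_, ?_⟩
  · rw [dim_configurationOf, Finset.sum_singleton, hWr, Nat.add_sub_cancel]
  · rw [length_configurationOf, Finset.card_singleton]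

theorem exists_configuration_of_onTwo {a b : ℕ} (ha : 1 ≤ a) (hb : 1 ≤ b) (hn : 1 ≤ n)
    (hΓ : OnTwo (a + 1) (b + 1) Γ) :
    ∃ C : PlaneConfiguration K n, (Γ : Set (ProjSpace K n)) ⊆ C.carrier ∧
      C.dim = min (a + b) n ∧ C.length ≤ 2 := by
  classical
  have htop : prank Γ ≤ n + 1 := (Submodule.finrank_le _).trans (by simp)
  rcases Nat.lt_or_ge n (a + b) with hlt | hle
  · obtain ⟨C, h1, h2, h3⟩ := exists_configuration_of_prank (Γ := Γ) (d := a + b) (by omega) hn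
      (by omega)
    exact ⟨C, h1, h2, by omega⟩
  obtain ⟨U, W, hU, hW, hUW⟩ := hΓ
  obtain ⟨U', hU', hUr⟩ := exists_le_finrank_eq hU (by omega)
  obtain ⟨W', hW', hWr⟩ := exists_le_finrank_eq hW (by omega)
  -- Members must be distinct, so if the enlarged spaces coincide, a single space of the full
  -- dimension `a + b` replaces them.
  by_cases he : U' = W'
  · obtain ⟨C, h1, h2, h3⟩ := exists_configuration_of_prank (Γ := Γ) (d := a + b) (by omega) hn
      ((prank_le_finrank (U := U') fun x hx => (hUW x hx).elim (fun h => hU' h)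
        fun h => he ▸ hW' h).trans (by omega))
    exact ⟨C, h1, h2, by omega⟩
  refine ⟨configurationOf {U', W'} (by
    simp only [Finset.mem_insert, Finset.mem_singleton, forall_eq_or_imp, forall_eq]
    omega), fun x hx => mem_carrier_configurationOf.2 ?_, ?_, ?_⟩
  · rcases hUW x hx with h | h
    · exact ⟨U', by simp, hU' h⟩
    · exact ⟨W', by simp, hW' h⟩
  · rw [dim_configurationOf, Finset.sum_pair he]
    omega
  · rw [length_configurationOf, Finset.card_pair he]

theorem exists_configuration_of_onThreeLines (hn : 1 ≤ n) (hΓ : OnThreeLines Γ) :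
    ∃ C : PlaneConfiguration K n, (Γ : Set (ProjSpace K n)) ⊆ C.carrier ∧ C.dim = min 3 n := by
  classical
  by_cases h2 : OnTwo 3 2 Γ
  · obtain ⟨C, h1, h2, -⟩ := exists_configuration_of_onTwo (a := 2) (b := 1) (by omega) (by omega)
      hn h2
    exact ⟨C, h1, h2⟩
  rcases Nat.lt_or_ge n 3 with hlt | hle
  · have htop : prank Γ ≤ n + 1 := (Submodule.finrank_le _).trans (by simp)
    obtain ⟨C, h1, h2, h3⟩ := exists_configuration_of_prank (Γ := Γ) (d := 3) (by omega) hn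
      (by omega)
    exact ⟨C, h1, h2⟩
  obtain ⟨U, V, W, hU, hV, hW, hc⟩ := hΓ
  obtain ⟨U', hU', hUr⟩ := exists_le_finrank_eq hU (by omega)
  obtain ⟨V', hV', hVr⟩ := exists_le_finrank_eq hV (by omega)
  obtain ⟨W', hW', hWr⟩ := exists_le_finrank_eq hW (by omega)
  have hc' : ∀ x ∈ Γ, x.rep ∈ U' ∨ x.rep ∈ V' ∨ x.rep ∈ W' := fun x hx =>
    (hc x hx).imp (fun h => hU' h) fun h => h.imp (fun h => hV' h) fun h => hW' h
  have hUV : U' ≠ V' := by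
    rintro rfl
    exact h2 ⟨U', W', by omega, by omega, fun x hx => by have := hc' x hx; tauto⟩
  have hUW : U' ≠ W' := by
    rintro rfl
    exact h2 ⟨U', V', by omega, by omega, fun x hx => by have := hc' x hx; tauto⟩
  have hVW : V' ≠ W' := by
    rintro rfl
    exact h2 ⟨U', V', by omega, by omega, fun x hx => by have := hc' x hx; tauto⟩
  refine ⟨configurationOf {U', V', W'} (by
    simp only [Finset.mem_insert, Finset.mem_singleton, forall_eq_or_imp, forall_eq]
    omega), fun x hx => mem_carrier_configurationOf.2 ?_, ?_⟩
  · rcases hc' x hx with h | h | h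
    · exact ⟨U', by simp, h⟩
    · exact ⟨V', by simp, h⟩
    · exact ⟨W', by simp, h⟩
  · rw [dim_configurationOf, Finset.sum_insert (by simp [hUV, hUW]), Finset.sum_pair hVW]
    omega

/-- If `d = 0` there are at most `r + 1` points, and if `n = 0` the ambient space is one point;
either is below the minimum `r + 2` or `2`. -/
theorem CayleyBacharach.eq_empty {r d : ℕ} (h : CayleyBacharach r (Γ : Set (ProjSpace K n)))
    (hc : Γ.card ≤ (d + 1) * r + 1) (hdn : min d n = 0) : Γ = ∅ := by
  by_contra hne
  have h1 := h.add_two_le_card (Finset.nonempty_iff_ne_empty.2 hne)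
  rcases Nat.eq_zero_or_pos d with rfl | hd
  · omega
  · have h2 := card_le_one_of_finrank_le_one (Γ := Γ) (U := ⊤)
      (by rw [finrank_top, Module.finrank_fin_fun]; omega) fun _ _ => trivial
    omega

end Configurations

/-! ### Assembling the three cases -/

theorem theorem1p2 {K : Type*} [Field K] [Infinite K] (n r d : ℕ) (Γ : Finset (ProjSpace K n))
    (hCB : CayleyBacharach r (Γ : Set (ProjSpace K n)))
    (hcard : Γ.card ≤ (d + 1) * r + 1) :
    (r ≤ 2 → ∃ C : PlaneConfiguration K n, (Γ : Set (ProjSpace K n)) ⊆ C.carrier ∧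
      C.dim = min d n ∧ (1 ≤ d → 1 ≤ n → C.length = 1)) ∧
    (d ≤ 3 → ∃ C : PlaneConfiguration K n, (Γ : Set (ProjSpace K n)) ⊆ C.carrier ∧
      C.dim = min d n ∧ (r ≤ 4 → C.length ≤ 2)) ∧
    (d = 4 → r = 3 → ∃ C : PlaneConfiguration K n, (Γ : Set (ProjSpace K n)) ⊆ C.carrier ∧
      C.dim = min d n ∧ C.length ≤ 2) := by
  -- Members have positive dimension, so dimension zero leaves only the empty configuration.
  by_cases hdn : min d n = 0
  · obtain rfl := hCB.eq_empty hcard hdn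
    obtain ⟨C, h1, h2, h3⟩ := exists_configuration_empty (K := K) (n := n)
    exact ⟨fun _ => ⟨C, h1, by omega, fun _ _ => by omega⟩,
      fun _ => ⟨C, h1, by omega, fun _ => by omega⟩, fun _ _ => ⟨C, h1, by omega, by omega⟩⟩
  have hd : 1 ≤ d := by omega
  have hn : 1 ≤ n := by omega
  refine ⟨fun hr => ?_, fun hd3 => ?_, fun hd4 hr3 => ?_⟩
  · obtain ⟨C, h1, h2, h3⟩ := exists_configuration_of_prank hd hn
      (hCB.prank_le_of_le_two hr hcard)
    exact ⟨C, h1, h2, fun _ _ => h3⟩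
  · have hlin : prank Γ ≤ d + 1 → ∃ C : PlaneConfiguration K n,
        (Γ : Set (ProjSpace K n)) ⊆ C.carrier ∧ C.dim = min d n ∧ (r ≤ 4 → C.length ≤ 2) := by
      intro h
      obtain ⟨C, h1, h2, h3⟩ := exists_configuration_of_prank hd hn h
      exact ⟨C, h1, h2, fun _ => by omega⟩
    interval_cases d
    · exact hlin (hCB.prank_le_two (by omega))
    · rcases hCB.plane_or_two_lines (by omega) with h | h
      · exact hlin h
      · obtain ⟨C, h1, h2, h3⟩ := exists_configuration_of_onTwo (a := 1) (b := 1) (by omega)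
          (by omega) hn h
        exact ⟨C, h1, h2, fun _ => h3⟩
    · have htwo : OnTwo 3 2 Γ → ∃ C : PlaneConfiguration K n,
          (Γ : Set (ProjSpace K n)) ⊆ C.carrier ∧ C.dim = min 3 n ∧ (r ≤ 4 → C.length ≤ 2) := by
        intro h
        obtain ⟨C, h1, h2, h3⟩ := exists_configuration_of_onTwo (a := 2) (b := 1) (by omega)
          (by omega) hn h
        exact ⟨C, h1, h2, fun _ => h3⟩
      by_cases hr : r ≤ 4
      · exact (hCB.dim_three_short hr (by omega)).elim hlin htwo
      · rcases hCB.dim_three (by omega) with h | h | h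
        · exact hlin h
        · exact htwo h
        · obtain ⟨C, h1, h2⟩ := exists_configuration_of_onThreeLines hn h
          exact ⟨C, h1, h2, fun h => absurd h hr⟩
  · subst hd4 hr3
    rcases hCB.dim_four (by omega) with h | h | h
    · obtain ⟨C, h1, h2, h3⟩ := exists_configuration_of_prank hd hn h
      exact ⟨C, h1, h2, by omega⟩
    · exact exists_configuration_of_onTwo (a := 3) (b := 1) (by omega) (by omega) hn h
    · exact exists_configuration_of_onTwo (a := 2) (b := 2) (by omega) (by omega) hn h
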